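/- Let a connected Lie group $G$ with Lie algebra $\mathfrak g$ act smoothly, freely and properly on the left on a (finite-dimensional, Hausdorff, second countable) smooth manifold $M$. Let $g$ be a $G$-invariant Riemannian metric and $V$ a $G$-invariant smooth function on $M$, let $L(w)=\frac12 g(w,w)-V(\tau(w))$ on $\tau:TM\to M$, and let $\Gamma$ be the Euler–Lagrange field of $L$. For $\xi\in\mathfrak g$ let $\tilde\xi$ be the fundamental vector field on $M$ and $\tilde\xi^{C}$ its complete lift to $TM$. Fix $\mu\in\mathfrak g^*$; let $\iota:N_\mu\to TM$ be the inclusion of the momentum level set $\{w : \tilde\xi^V(L)(w)=\langle\mu,\xi\rangle\ \forall\xi\in\mathfrak g\}$, $G_\mu$ the isotropy group of $\mu$ for the coadjoint action, $\mathfrak g_\mu=\{\xi : \langle\mu,[\xi,\eta]\rangle=0\ \forall\eta\in\mathfrak g\}$ its Lie algebra, and $j:\mathfrak g_\mu\to\mathfrak g$ the inclusion. Let $I(m):\mathfrak g\to\mathfrak g^*$, $\langle I(m)\xi,\eta\rangle=g(\tilde\xi,\tilde\eta)(m)$, be the locked inertia tensor and $I_\mu(m)=j^*\circ I(m)\circ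 j$. Connections: $\omega$ is the mechanical connection on $M\to M/G$ (horizontal spaces orthogonal to the $G$-orbits); $\omega^\mu$ is the $\mathfrak g_\mu$-valued connection form on $M\to M/G_\mu$ whose horizontal spaces are orthogonal to $\{\tilde\xi:\xi\in\mathfrak g_\mu\}$; $\Omega^{\mathrm{mech}}$ is the connection on $N_\mu\to N_\mu/G_\mu$ for which $W$ is horizontal iff the Hessian of $L$ along the fibres vanishes on $(\tilde\xi,T\tau W)$ for all $\xi\in\mathfrak g_\mu$; and $\Omega^{N_\mu}=\Omega^{\mathrm{mech}}\circ\Omega^V$, where $\Omega^V(Z)=\bar\xi^{C}$ with $\xi=\omega(T(\tau\circ\iota)Z)$ and $\bar\xi^{C}$ is the unique vector tangent to $N_\mu$ of the form $\tilde\xi^{C}+(\tilde\zeta)^V$, $\zeta\in\mathfrak g$. Let $\{E_A\}$ be a basis of $\mathfrak g_\mu$, $\mu_A=\langle\mu,E_A\rangle$ and $g_{AB}(m)=g(\tilde E_A,\tilde E_B)(m)$. Then: 1. $\Omega^{\mathrm{mech}}=\Omega^{N_\mu}$ on $TN_\mu$; call it $\Omega$. 2. $(g_{AB}(m))$ is invertible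 for all $m$, with inverse $(G^{AB}(m))$, and $\Omega(\Gamma)=G^{AB}\mu_B\,\tilde E_A^{C}$ on $N_\mu$. Moreover $I_\mu(m)$ is invertible and $G^{AB}(m)\mu_BE_A=I_\mu^{-1}(m)(j^*\mu)$. 3. $\Gamma$ is tangent to $N_\mu$ and projects to a vector field $\check\Gamma$ on $N_\mu/G_\mu$. Let $\check v$ be an integral curve of $\check\Gamma$ on an open interval $J$, $\check v^H$ an $\Omega$-horizontal lift of it to $N_\mu$, and $c=\tau\circ\iota\circ\check v^H$. Then $c$ is $\omega^\mu$-horizontal: $\omega^\mu(\dot c)=0$. 4. With $\vartheta$ the left Maurer–Cartan form, for every differentiable curve $h:J\to G_\mu$ and $t\in J$, the reconstruction equation $\widetilde{\vartheta(\dot h)}^{C}(\check v^H)=\Omega(\Gamma(\check v^H))$ is equivalent to $$\vartheta(\dot h(t))=I_\mu^{-1}(c(t))(j^*\mu).$$ 5. The last equation is also equivalent to the case $q=c$ of the equation $\vartheta(\dot h)=I_\mu^{-1}(q)(j^*\mu)-\omega^\mu(\dot q)$ (equation (IV.6) of Marsden–Ratiu–Scheurle, for curves $q$ in $M$), whose extra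 term vanishes for $q=c$. 6. If $h$ satisfies it for all $t\in J$, then $t\mapsto Th(t)\cdot\check v^H(t)$ (the induced action of $G_\mu$ on $N_\mu$) is an integral curve of $\Gamma$ lying in $N_\mu$, and it projects to $t\mapsto h(t)\cdot c(t)$ in $M$, which is thus a base integral curve of $\Gamma$. -/

import Mathlib

open Set Filter Topology Manifold ContDiff Bundle

namespace Routh

noncomputable section

/-! ### Manifolds, tangent vectors, curves -/

section Curves

variable {F : Type*} [NormedAddCommGroup F] [NormedSpace ℝ F]
  {H : Type*} [TopologicalSpace H] (I : ModelWithCorners ℝ F H)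
  {N : Type*} [TopologicalSpace N] [ChartedSpace H N]

/-- The velocity vector `γ̇(t)` of a curve in a manifold. -/
def velocity (γ : ℝ → N) (t : ℝ) : TangentSpace I (γ t) :=
  mfderiv 𝓘(ℝ, ℝ) I γ t (1 : ℝ)

end Curves

section LieGroup

variable {EG : Type*} [NormedAddCommGroup EG] [NormedSpace ℝ EG]
  {G : Type*} [TopologicalSpace G] [ChartedSpace EG G] [Group G]

/-- The (left) Maurer-Cartan form: `ϑ(X) = T(L_{h⁻¹}) X` for `X ∈ T_h G`. -/
def maurerCartan (h : G) (X : TangentSpace 𝓘(ℝ, EG) h) : GroupLieAlgebra 𝓘(ℝ, EG) G :=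
  mfderiv 𝓘(ℝ, EG) 𝓘(ℝ, EG) (fun x : G => h⁻¹ * x) h X

/-- The adjoint action of `h` on the Lie algebra: the derivative at the identity of
`x ↦ h x h⁻¹`. -/
def Ad (h : G) (ξ : GroupLieAlgebra 𝓘(ℝ, EG) G) : GroupLieAlgebra 𝓘(ℝ, EG) G :=
  mfderiv 𝓘(ℝ, EG) 𝓘(ℝ, EG) (fun x : G => h * x * h⁻¹) 1 ξ

/-- The isotropy group `G_μ` of `μ` for the coadjoint action `⟨ξ, ad*_h μ⟩ = ⟨ad_h ξ, μ⟩`. -/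
def isotropyGroup (μ : Module.Dual ℝ (GroupLieAlgebra 𝓘(ℝ, EG) G)) : Set G :=
  {h | ∀ ξ, μ (Ad h ξ) = μ ξ}

/-- The isotropy algebra `𝔤_μ`: all `ξ` with `μ([ξ, η]) = 0` for every `η`. -/
def isotropyAlgebra [FiniteDimensional ℝ EG] [LieGroup 𝓘(ℝ, EG) ∞ G]
    (μ : Module.Dual ℝ (GroupLieAlgebra 𝓘(ℝ, EG) G)) :
    Submodule ℝ (GroupLieAlgebra 𝓘(ℝ, EG) G) :=
  haveI : LieGroup 𝓘(ℝ, EG) (minSmoothness ℝ 3) G :=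
    LieGroup.of_le (n := ∞) (by simp only [minSmoothness_of_isRCLikeNormedField]; exact ENat.LEInfty.out)
  haveI : CompleteSpace EG := FiniteDimensional.complete ℝ EG
  { carrier := {ξ | ∀ η, μ ⁅ξ, η⁆ = 0}
    add_mem' := fun {a b} ha hb η => by
      rw [add_lie, map_add, ha η, hb η, add_zero]
    zero_mem' := fun η => by rw [zero_lie, map_zero]
    smul_mem' := fun r a ha η => by
      rw [smul_lie, map_smul, ha η, smul_zero] }

open Classical in
/-- The unique `ξ` with the property `P`, when there is exactly one. -/
def theUnique {𝔤 : Type*} [Zero 𝔤] (P : 𝔤 → Prop) : 𝔤 :=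
  if h : ∃! ξ, P ξ then h.choose else 0

end LieGroup

/-! ### Lifts from `M` to `TM`, Lagrangians -/

section Tangent

variable {E : Type*} [NormedAddCommGroup E] [NormedSpace ℝ E]
  {M : Type*} [TopologicalSpace M] [ChartedSpace E M] [IsManifold 𝓘(ℝ, E) ∞ M]

/-- `Tτ : T_w TM → T_{τ(w)} M`, where `τ : TM → M`. -/
def tangentProj (w : TangentBundle 𝓘(ℝ, E) M) :
    TangentSpace 𝓘(ℝ, E).tangent w →L[ℝ] TangentSpace 𝓘(ℝ, E) w.proj :=
  mfderiv 𝓘(ℝ, E).tangent 𝓘(ℝ, E) (fun w' : TangentBundle 𝓘(ℝ, E) M => w'.proj) w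

/-- The vertical lift of `u ∈ T_m M` to `w ∈ T_m M`. The tangent space `T_w TM` is `E × E`
through the chart of `TM` induced by the preferred chart of `M` at `m`; in it the vertical lift
has components `(0, u)`. -/
def verticalLift (w : TangentBundle 𝓘(ℝ, E) M) (u : TangentSpace 𝓘(ℝ, E) w.proj) :
    TangentSpace 𝓘(ℝ, E).tangent w :=
  ((0 : E), (u : E))

/-- The complete (tangent) lift of a vector field `Z` on `M`, at `w ∈ T_m M`. In the chart of `TM`
induced by the preferred chart of `M` at `m` its components are
`(Z^α, (∂Z^α/∂x^β) w^β)`: the second entry is the fibre component of the derivative of the section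
`Z` in the direction `w`. -/
def completeLift (Z : ∀ m : M, TangentSpace 𝓘(ℝ, E) m) (w : TangentBundle 𝓘(ℝ, E) M) :
    TangentSpace 𝓘(ℝ, E).tangent w :=
  ((Z w.proj : E),
    ((mfderiv 𝓘(ℝ, E) 𝓘(ℝ, E).tangent
      (fun m : M => (⟨m, Z m⟩ : TangentBundle 𝓘(ℝ, E) M)) w.proj w.snd : E × E)).2)

/-- `u^V(L)` at `w`: the derivative of `L` at `w` along the fibre in the direction `u`. -/
def fibreDeriv (L : TangentBundle 𝓘(ℝ, E) M → ℝ) (w : TangentBundle 𝓘(ℝ, E) M)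
    (u : TangentSpace 𝓘(ℝ, E) w.proj) : ℝ :=
  deriv (fun s : ℝ => L ⟨w.proj, w.snd + s • u⟩) 0

/-- The Hessian `g_w(u, v) = u^V v^V (L)` of a Lagrangian, a bilinear form on `T_{τ(w)} M`. -/
def hessian (L : TangentBundle 𝓘(ℝ, E) M → ℝ) (w : TangentBundle 𝓘(ℝ, E) M)
    (u v : TangentSpace 𝓘(ℝ, E) w.proj) : ℝ :=
  deriv (fun s : ℝ => fibreDeriv L ⟨w.proj, w.snd + s • u⟩ v) 0

/-- `Γ` is the Euler-Lagrange field of `L`: it is a second-order differential equation field and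
`Γ(Z^V(L)) - Z^C(L) = 0` for all (local) smooth vector fields `Z` on `M`. -/
structure IsEulerLagrangeField (L : TangentBundle 𝓘(ℝ, E) M → ℝ)
    (Γ : ∀ w : TangentBundle 𝓘(ℝ, E) M, TangentSpace 𝓘(ℝ, E).tangent w) : Prop where
  secondOrder : ∀ w, tangentProj w (Γ w) = w.snd
  eulerLagrange : ∀ (Z : ∀ m : M, TangentSpace 𝓘(ℝ, E) m) (w : TangentBundle 𝓘(ℝ, E) M),
    ContMDiffAt 𝓘(ℝ, E) 𝓘(ℝ, E).tangent ∞
      (fun m : M => (⟨m, Z m⟩ : TangentBundle 𝓘(ℝ, E) M)) w.proj →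
    mfderiv 𝓘(ℝ, E).tangent 𝓘(ℝ, ℝ)
        (fun w' : TangentBundle 𝓘(ℝ, E) M => fibreDeriv L w' (Z w'.proj)) w (Γ w)
      = mfderiv 𝓘(ℝ, E).tangent 𝓘(ℝ, ℝ) L w (completeLift Z w)

/-- The Lagrangian `L = T - V` of a simple mechanical system, with kinetic energy
`T(w) = ½ g(w, w)`. -/
def simpleLagrangian
    (g : ContMDiffRiemannianMetric 𝓘(ℝ, E) ∞ E (fun m : M => TangentSpace 𝓘(ℝ, E) m))
    (V : M → ℝ) (w : TangentBundle 𝓘(ℝ, E) M) : ℝ :=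
  1 / 2 * g.inner w.proj w.snd w.snd - V w.proj

end Tangent

/-! ### Lagrangians with symmetry -/

section Symmetry

variable {E : Type*} [NormedAddCommGroup E] [NormedSpace ℝ E]
  {M : Type*} [TopologicalSpace M] [ChartedSpace E M] [IsManifold 𝓘(ℝ, E) ∞ M]
  {EG : Type*} [NormedAddCommGroup EG] [NormedSpace ℝ EG] [FiniteDimensional ℝ EG]
  {G : Type*} [TopologicalSpace G] [ChartedSpace EG G] [Group G] [LieGroup 𝓘(ℝ, EG) ∞ G]
  [MulAction G M]

/-- The fundamental vector field `ξ̃` on `M`: the infinitesimal generator of the action, as the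
linear map `ξ ↦ ξ̃(m)`, i.e. the derivative at the identity of `h ↦ h • m`. -/
def fund (m : M) : GroupLieAlgebra 𝓘(ℝ, EG) G →L[ℝ] TangentSpace 𝓘(ℝ, E) m :=
  mfderiv 𝓘(ℝ, EG) 𝓘(ℝ, E) (fun h : G => h • m) 1

/-- The complete lift `ξ̃^C` of the fundamental vector field `ξ̃`: the fundamental vector field of
the induced action on `TM`. -/
def fundC (ξ : GroupLieAlgebra 𝓘(ℝ, EG) G) (w : TangentBundle 𝓘(ℝ, E) M) :
    TangentSpace 𝓘(ℝ, E).tangent w :=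
  completeLift (fun m : M => fund m ξ) w

/-- The induced action `ψ^{TM}_h = Tψ^M_h` of `G` on `TM`. -/
def tangentAction (h : G) : TangentBundle 𝓘(ℝ, E) M → TangentBundle 𝓘(ℝ, E) M :=
  tangentMap 𝓘(ℝ, E) 𝓘(ℝ, E) (fun m : M => h • m)

/-- The momentum `p_ξ = ξ̃^V(L)`. -/
def momentum (L : TangentBundle 𝓘(ℝ, E) M → ℝ) (w : TangentBundle 𝓘(ℝ, E) M)
    (ξ : GroupLieAlgebra 𝓘(ℝ, EG) G) : ℝ :=
  fibreDeriv L w (fund w.proj ξ)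

/-- The level set `N_μ` of momentum. -/
def levelSet (L : TangentBundle 𝓘(ℝ, E) M → ℝ)
    (μ : Module.Dual ℝ (GroupLieAlgebra 𝓘(ℝ, EG) G)) : Set (TangentBundle 𝓘(ℝ, E) M) :=
  {w | ∀ ξ, momentum L w ξ = μ ξ}

variable (EG G) in
/-- The tangent space at `w` of the regular level set of momentum through `w`: the common kernel
of the differentials of the momenta `p_ξ`. -/
def levelTangent (L : TangentBundle 𝓘(ℝ, E) M → ℝ) (w : TangentBundle 𝓘(ℝ, E) M) :
    Submodule ℝ (TangentSpace 𝓘(ℝ, E).tangent w) :=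
  ⨅ ξ : GroupLieAlgebra 𝓘(ℝ, EG) G,
    LinearMap.ker (mfderiv 𝓘(ℝ, E).tangent 𝓘(ℝ, ℝ)
      (fun w' : TangentBundle 𝓘(ℝ, E) M => momentum L w' ξ) w).toLinearMap

/-! ### Two principal connections on the level set

Connections on `N_μ → N_μ/G_μ` are type (1,1) tensor fields on `N_μ` projecting each `T_w N_μ` onto
the vertical space `{ξ̃^C(w) | ξ ∈ 𝔤_μ}`. -/

/-- `W` is horizontal for the mechanical connection on `N_μ`: it is `g`-orthogonal, along `τ`, to
`ξ̃` for all `ξ ∈ 𝔤_μ`, where `g` is the Hessian of `L`. -/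
def IsMechHorizontal (L : TangentBundle 𝓘(ℝ, E) M → ℝ)
    (μ : Module.Dual ℝ (GroupLieAlgebra 𝓘(ℝ, EG) G)) (w : TangentBundle 𝓘(ℝ, E) M)
    (W : TangentSpace 𝓘(ℝ, E).tangent w) : Prop :=
  ∀ ξ ∈ isotropyAlgebra μ, hessian L w (fund w.proj ξ) (tangentProj w W) = 0

/-- The mechanical connection `Ω^mech` on `N_μ`: `Ω^mech(Z) = ξ̃^C(w)` for the unique `ξ ∈ 𝔤_μ` for
which `Z - ξ̃^C(w)` is horizontal. -/
def mechConnection (L : TangentBundle 𝓘(ℝ, E) M → ℝ)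
    (μ : Module.Dual ℝ (GroupLieAlgebra 𝓘(ℝ, EG) G)) (w : TangentBundle 𝓘(ℝ, E) M)
    (Z : TangentSpace 𝓘(ℝ, E).tangent w) : TangentSpace 𝓘(ℝ, E).tangent w :=
  fundC (theUnique fun ξ : GroupLieAlgebra 𝓘(ℝ, EG) G =>
    ξ ∈ isotropyAlgebra μ ∧ IsMechHorizontal L μ w (Z - fundC ξ w)) w

/-- The vector `ξ̄^C(w) = ξ̃^C(w) + (ζ̃)^V(w)`, with `ζ ∈ 𝔤` determined by the requirement that the
sum is tangent to the level set of momentum. -/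
def fundBar (L : TangentBundle 𝓘(ℝ, E) M → ℝ) (ξ : GroupLieAlgebra 𝓘(ℝ, EG) G)
    (w : TangentBundle 𝓘(ℝ, E) M) : TangentSpace 𝓘(ℝ, E).tangent w :=
  fundC ξ w + verticalLift w (fund w.proj
    (theUnique fun ζ : GroupLieAlgebra 𝓘(ℝ, EG) G =>
      fundC ξ w + verticalLift w (fund w.proj ζ) ∈ levelTangent EG G L w))

/-- The connection `Ω^V` on `N_μ → T(M/G)`, the vertical lift of a principal connection on
`M → M/G`, the latter being given by its `𝔤`-valued form `A`: identifying the vertical space at `w`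
with `𝔤` through `ξ ↦ ξ̄^C(w)`, one has `Ω^V(Z) = A(T(τ∘ι)Z)`. -/
def vliftConnection (L : TangentBundle 𝓘(ℝ, E) M → ℝ)
    (A : ∀ m : M, TangentSpace 𝓘(ℝ, E) m → GroupLieAlgebra 𝓘(ℝ, EG) G)
    (w : TangentBundle 𝓘(ℝ, E) M) (Z : TangentSpace 𝓘(ℝ, E).tangent w) :
    TangentSpace 𝓘(ℝ, E).tangent w :=
  fundBar L (A w.proj (tangentProj w Z)) w

/-- The connection `Ω^{N_μ} = Ω^mech ∘ Ω^V` on `N_μ → N_μ/G_μ`, for a principal connection `A` on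
`M → M/G`. -/
def levelConnection (L : TangentBundle 𝓘(ℝ, E) M → ℝ)
    (μ : Module.Dual ℝ (GroupLieAlgebra 𝓘(ℝ, EG) G))
    (A : ∀ m : M, TangentSpace 𝓘(ℝ, E) m → GroupLieAlgebra 𝓘(ℝ, EG) G)
    (w : TangentBundle 𝓘(ℝ, E) M) (Z : TangentSpace 𝓘(ℝ, E).tangent w) :
    TangentSpace 𝓘(ℝ, E).tangent w :=
  mechConnection L μ w (vliftConnection L A w Z)

/-! ### Metric connections on `M` and the locked inertia tensor -/

/-- The connection form on `M`, with values in `𝔨 ⊆ 𝔤`, whose horizontal spaces are the orthogonal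
complements of the spaces `{ξ̃(m) | ξ ∈ 𝔨}`. -/
def metricConnection
    (g : ContMDiffRiemannianMetric 𝓘(ℝ, E) ∞ E (fun m : M => TangentSpace 𝓘(ℝ, E) m))
    (𝔨 : Submodule ℝ (GroupLieAlgebra 𝓘(ℝ, EG) G)) (m : M) (u : TangentSpace 𝓘(ℝ, E) m) :
    GroupLieAlgebra 𝓘(ℝ, EG) G :=
  theUnique fun ξ : GroupLieAlgebra 𝓘(ℝ, EG) G =>
    ξ ∈ 𝔨 ∧ ∀ η ∈ 𝔨, g.inner m (u - fund m ξ) (fund m η) = 0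

variable (EG G) in
/-- The mechanical connection of a simple mechanical system on `M → M/G`. -/
def mechForm
    (g : ContMDiffRiemannianMetric 𝓘(ℝ, E) ∞ E (fun m : M => TangentSpace 𝓘(ℝ, E) m))
    (m : M) (u : TangentSpace 𝓘(ℝ, E) m) : GroupLieAlgebra 𝓘(ℝ, EG) G :=
  metricConnection g ⊤ m u

/-- The mechanical connection `ω^μ` for the `G_μ`-action, a connection on `M → M/G_μ`. -/
def mechFormSub
    (g : ContMDiffRiemannianMetric 𝓘(ℝ, E) ∞ E (fun m : M => TangentSpace 𝓘(ℝ, E) m))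
    (μ : Module.Dual ℝ (GroupLieAlgebra 𝓘(ℝ, EG) G)) (m : M) (u : TangentSpace 𝓘(ℝ, E) m) :
    GroupLieAlgebra 𝓘(ℝ, EG) G :=
  metricConnection g (isotropyAlgebra μ) m u

variable (EG G) in
/-- The locked inertia tensor `I(m) : 𝔤 → 𝔤*`, `I(m)(ξ)(η) = g(ξ̃(m), η̃(m))`. -/
def lockedInertia
    (g : ContMDiffRiemannianMetric 𝓘(ℝ, E) ∞ E (fun m : M => TangentSpace 𝓘(ℝ, E) m)) (m : M) :
    GroupLieAlgebra 𝓘(ℝ, EG) G →ₗ[ℝ] Module.Dual ℝ (GroupLieAlgebra 𝓘(ℝ, EG) G) :=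
  LinearMap.mk₂ ℝ (fun ξ η => g.inner m (fund m ξ) (fund m η))
    (fun a b c => by simp only [map_add, add_apply])
    (fun r a c => by simp only [map_smul, smul_apply])
    (fun a b c => by simp only [map_add])
    (fun r a c => by simp only [map_smul])

/-- `j*μ`, for the injection `j : 𝔤_μ → 𝔤`. -/
def restrictedMomentum (μ : Module.Dual ℝ (GroupLieAlgebra 𝓘(ℝ, EG) G)) :
    Module.Dual ℝ (isotropyAlgebra μ) :=
  (isotropyAlgebra μ).subtype.dualMap μ

/-- `I_μ(m) = j* ∘ I(m) ∘ j : 𝔤_μ → 𝔤_μ*`. -/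
def lockedInertiaSub
    (g : ContMDiffRiemannianMetric 𝓘(ℝ, E) ∞ E (fun m : M => TangentSpace 𝓘(ℝ, E) m))
    (μ : Module.Dual ℝ (GroupLieAlgebra 𝓘(ℝ, EG) G)) (m : M) :
    isotropyAlgebra μ →ₗ[ℝ] Module.Dual ℝ (isotropyAlgebra μ) :=
  (isotropyAlgebra μ).subtype.dualMap ∘ₗ lockedInertia EG G g m ∘ₗ (isotropyAlgebra μ).subtype

/-- `I_μ⁻¹(m)(j*μ)`, once `I_μ(m)` is known to be invertible, as an element of `𝔤`. -/
def inertiaInv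
    (g : ContMDiffRiemannianMetric 𝓘(ℝ, E) ∞ E (fun m : M => TangentSpace 𝓘(ℝ, E) m))
    (μ : Module.Dual ℝ (GroupLieAlgebra 𝓘(ℝ, EG) G))
    (hI : ∀ m : M, Function.Bijective (lockedInertiaSub g μ m)) (m : M) :
    GroupLieAlgebra 𝓘(ℝ, EG) G :=
  ((LinearEquiv.ofBijective (lockedInertiaSub g μ m) (hI m)).symm (restrictedMomentum μ) :
    isotropyAlgebra μ)

/-- The Marsden-Ratiu-Scheurle reconstruction equation, at time `t`, for a curve `q` in `M` and a
curve `h` in `G_μ`: `ϑ(ḣ) = I_μ⁻¹(q)(j*μ) - ω^μ(q̇)`. -/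
def MRSEquation
    (g : ContMDiffRiemannianMetric 𝓘(ℝ, E) ∞ E (fun m : M => TangentSpace 𝓘(ℝ, E) m))
    (μ : Module.Dual ℝ (GroupLieAlgebra 𝓘(ℝ, EG) G))
    (hI : ∀ m : M, Function.Bijective (lockedInertiaSub g μ m))
    (q : ℝ → M) (h : ℝ → G) (t : ℝ) : Prop :=
  maurerCartan (h t) (velocity 𝓘(ℝ, EG) h t)
    = inertiaInv g μ hI (q t) - mechFormSub g μ (q t) (velocity 𝓘(ℝ, E) q t)

/-! ### The reduced space `N_μ/G_μ` and its tangent vectors -/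

/-- The orbit space `N_μ/G_μ`. -/
def ReducedSpace (L : TangentBundle 𝓘(ℝ, E) M → ℝ)
    (μ : Module.Dual ℝ (GroupLieAlgebra 𝓘(ℝ, EG) G)) : Type _ :=
  Quot fun w w' : levelSet L μ => ∃ h ∈ isotropyGroup μ, 
    tangentAction h (w : TangentBundle 𝓘(ℝ, E) M) = (w' : TangentBundle 𝓘(ℝ, E) M)

/-- The projection `N_μ → N_μ/G_μ`. -/
def reducedMk (L : TangentBundle 𝓘(ℝ, E) M → ℝ)
    (μ : Module.Dual ℝ (GroupLieAlgebra 𝓘(ℝ, EG) G)) (w : levelSet L μ) : ReducedSpace L μ :=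
  Quot.mk _ w

/-- The tangent bundle `TN_μ`, as a subset of `T(TM)`. -/
def LevelTangentBundle (L : TangentBundle 𝓘(ℝ, E) M → ℝ)
    (μ : Module.Dual ℝ (GroupLieAlgebra 𝓘(ℝ, EG) G)) : Type _ :=
  {p : TangentBundle 𝓘(ℝ, E).tangent (TangentBundle 𝓘(ℝ, E) M) //
    p.proj ∈ levelSet L μ ∧ p.snd ∈ levelTangent EG G L p.proj}

/-- The tangent bundle `T(N_μ/G_μ)`, i.e. `TN_μ/TG_μ`: tangent vectors to `N_μ` are identified when
they differ by the tangent action of an element of `G_μ` and a vertical vector. -/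
def ReducedTangent (L : TangentBundle 𝓘(ℝ, E) M → ℝ)
    (μ : Module.Dual ℝ (GroupLieAlgebra 𝓘(ℝ, EG) G)) : Type _ :=
  Quot fun p q : LevelTangentBundle L μ =>
    ∃ h ∈ isotropyGroup μ, ∃ ξ ∈ isotropyAlgebra μ,
      q.1 = tangentMap 𝓘(ℝ, E).tangent 𝓘(ℝ, E).tangent (tangentAction h)
        ⟨p.1.proj, p.1.snd + fundC ξ p.1.proj⟩

/-- `Z ∈ T_w (TM)` is tangent to `N_μ` at `w`, and its image under the tangent map of
`N_μ → N_μ/G_μ` is `ζ`. -/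
def ProjectsTo {L : TangentBundle 𝓘(ℝ, E) M → ℝ}
    {μ : Module.Dual ℝ (GroupLieAlgebra 𝓘(ℝ, EG) G)} (w : levelSet L μ)
    (Z : TangentSpace 𝓘(ℝ, E).tangent (w : TangentBundle 𝓘(ℝ, E) M))
    (ζ : ReducedTangent L μ) : Prop :=
  ∃ hZ : Z ∈ levelTangent EG G L (w : TangentBundle 𝓘(ℝ, E) M),
    (Quot.mk _ (⟨⟨w, Z⟩, w.2, hZ⟩ : LevelTangentBundle L μ) : ReducedTangent L μ) = ζ

/-- The curve `v` in `N_μ/G_μ` has velocity `ζ` at time `t`: near `t` it is the projection of a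
curve in `N_μ` that is differentiable at `t`, and the velocity of any such curve projects to `ζ`. -/
def HasReducedVelocityAt {L : TangentBundle 𝓘(ℝ, E) M → ℝ}
    {μ : Module.Dual ℝ (GroupLieAlgebra 𝓘(ℝ, EG) G)} (v : ℝ → ReducedSpace L μ) (t : ℝ)
    (ζ : ReducedTangent L μ) : Prop :=
  (∃ n : ℝ → levelSet L μ, (∀ᶠ s in 𝓝 t, reducedMk L μ (n s) = v s) ∧
    MDifferentiableAt 𝓘(ℝ, ℝ) 𝓘(ℝ, E).tangent
      (fun s => (n s : TangentBundle 𝓘(ℝ, E) M)) t) ∧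
  ∀ n : ℝ → levelSet L μ, (∀ᶠ s in 𝓝 t, reducedMk L μ (n s) = v s) →
    MDifferentiableAt 𝓘(ℝ, ℝ) 𝓘(ℝ, E).tangent
      (fun s => (n s : TangentBundle 𝓘(ℝ, E) M)) t →
    ProjectsTo (n t) (velocity 𝓘(ℝ, E).tangent
      (fun s => (n s : TangentBundle 𝓘(ℝ, E) M)) t) ζ

/-- `Γr` is the reduced vector field on `N_μ/G_μ`: the projection of the restriction of `Γ` to
`N_μ` (which is, in particular, tangent to `N_μ`). -/
def IsReducedField {L : TangentBundle 𝓘(ℝ, E) M → ℝ}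
    {μ : Module.Dual ℝ (GroupLieAlgebra 𝓘(ℝ, EG) G)}
    (Γ : ∀ w : TangentBundle 𝓘(ℝ, E) M, TangentSpace 𝓘(ℝ, E).tangent w)
    (Γr : ReducedSpace L μ → ReducedTangent L μ) : Prop :=
  ∀ w : levelSet L μ, ProjectsTo w (Γ w) (Γr (reducedMk L μ w))

/-- `v` is, on the set `J` of times, an integral curve of a vector field on `N_μ/G_μ`. -/
def IsReducedIntegralCurveOn {L : TangentBundle 𝓘(ℝ, E) M → ℝ}
    {μ : Module.Dual ℝ (GroupLieAlgebra 𝓘(ℝ, EG) G)} (v : ℝ → ReducedSpace L μ)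
    (Γr : ReducedSpace L μ → ReducedTangent L μ) (J : Set ℝ) : Prop :=
  ∀ t ∈ J, HasReducedVelocityAt v t (Γr (v t))

/-- `n` is, on the set `J` of times, a horizontal lift to `N_μ` of the curve `v` in `N_μ/G_μ`, for
the connection `Ω`. -/
structure IsHorizontalLiftOn {L : TangentBundle 𝓘(ℝ, E) M → ℝ}
    {μ : Module.Dual ℝ (GroupLieAlgebra 𝓘(ℝ, EG) G)}
    (Ω : ∀ w : TangentBundle 𝓘(ℝ, E) M,
      TangentSpace 𝓘(ℝ, E).tangent w → TangentSpace 𝓘(ℝ, E).tangent w)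
    (n : ℝ → levelSet L μ) (v : ℝ → ReducedSpace L μ) (J : Set ℝ) : Prop where
  lift : ∀ t ∈ J, reducedMk L μ (n t) = v t
  differentiable : ∀ t ∈ J, MDifferentiableAt 𝓘(ℝ, ℝ) 𝓘(ℝ, E).tangent
    (fun s => (n s : TangentBundle 𝓘(ℝ, E) M)) t
  horizontal : ∀ t ∈ J, Ω (n t) (velocity 𝓘(ℝ, E).tangent
    (fun s => (n s : TangentBundle 𝓘(ℝ, E) M)) t) = 0

end Symmetry

end

end Routh

/-! For `L = T - V` the fibre Hessian is `g` at the base point (`hessian_simpleLagrangian`). Hence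
`Ω^mech` sees its argument only through `Tτ`, and it, `ω` and `ω^μ` are all one construction: the
g-orthogonal projection onto `{ξ̃(m) | ξ ∈ 𝔨}`, read in `𝔨` (`metricConnection`). Freeness makes `ξ
↦ ξ̃(m)` injective (`fund_injective`), so the form induced on `𝔨` is positive definite; this yields
the projections and the invertibility of `g_AB` and `I_μ`. The two connections on `N_μ` agree
because `Tτ` kills the vertical correction in `Ω^V` and projections onto nested spaces compose
(`metricConnection_comp`). Since `Tτ Γ(w) = w`, and `g(w, ζ̃) = μ(ζ)` on `N_μ`, projecting `Γ`
amounts to solving `I_μ ξ = j*μ` (`metricConnection_levelSet`).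

Tangency of `Γ` to `N_μ` is Noether's theorem (`eulerLagrangeField_mem_levelTangent`); its
invariance (`eulerLagrangeField_tangentAction`) follows from uniqueness of the Euler-Lagrange field.
Along a horizontal lift `vH` of an integral curve of the reduced field, `Γ(vH)` is the velocity of
`vH` plus some `ξ̃^C` with `ξ ∈ 𝔤_μ` (`ProjectsTo.exists_eq_add_fundC`), and horizontality forces `ξ
= I_μ⁻¹(j*μ)`. By the product rule (`velocity_tangentAction`), `Th · vH` has velocity the image
under `T(Th)` of the velocity of `vH` plus `ϑ(ḣ)^C`. If `ϑ(ḣ) = ξ`, this is the image of `Γ(vH)`,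
and invariance of `Γ` concludes.

The analytic input is the symmetry of second derivatives in charts of `TM`. It gives both the
naturality of complete lifts (`completeLift_related`) and the fact that `ξ̃^C` generates the action
on `TM` (`fundC_eq_mfderiv`). -/

namespace Routh

/-! ### The second tangent map in charts, and its symmetry -/

section Calculus

variable {E : Type*} [NormedAddCommGroup E] [NormedSpace ℝ E]
  {M : Type*} [TopologicalSpace M] [ChartedSpace E M] [IsManifold 𝓘(ℝ, E) ∞ M]
  {E' : Type*} [NormedAddCommGroup E'] [NormedSpace ℝ E']
  {M' : Type*} [TopologicalSpace M'] [ChartedSpace E' M'] [IsManifold 𝓘(ℝ, E') ∞ M']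

/-- Charts of `TM` are tangent maps of charts of `M`; this turns statements about `T(TM)` into
statements about pairs in `E × E`. -/
theorem extChartAt_tangentBundle_apply {p q : TangentBundle 𝓘(ℝ, E) M}
    (h : q.1 ∈ (chartAt E p.1).source) :
    extChartAt 𝓘(ℝ, E).tangent p q
      = ((extChartAt 𝓘(ℝ, E) p.1 q.1 : E),
          (mfderiv 𝓘(ℝ, E) 𝓘(ℝ, E) (extChartAt 𝓘(ℝ, E) p.1) q.1 q.2 : E)) := by
  have := tangentMap_chart (I := 𝓘(ℝ, E)) (p := p) (q := q) h
  have h2 : extChartAt 𝓘(ℝ, E).tangent p q = (chartAt (ModelProd E E) p : _ → ModelProd E E) q := by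
    simp only [mfld_simps]
  rw [h2]
  have h3 : (chartAt (ModelProd E E) p : _ → ModelProd E E) q = TotalSpace.toProd E E
    (tangentMap 𝓘(ℝ, E) 𝓘(ℝ, E) (chartAt E p.1) q) := by
    rw [this]; simp
  rw [h3]
  have h4 : (extChartAt 𝓘(ℝ, E) p.1 : M → E) = chartAt E p.1 := by
    simp only [mfld_simps]
  rw [h4]
  rfl

theorem extChartAt_tangentBundle_symm_apply {p : TangentBundle 𝓘(ℝ, E) M} {q : E × E}
    (h : q.1 ∈ (chartAt E p.1).target) :
    (extChartAt 𝓘(ℝ, E).tangent p).symm q = tangentMap 𝓘(ℝ, E) 𝓘(ℝ, E) (chartAt E p.1).symm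
      ⟨q.1, q.2⟩ := by
  rw [tangentMap_chart_symm (I := 𝓘(ℝ, E)) (p := p) h]
  rfl

/-- The chart of `TM` at `w` covers the chart of `M` at `τ(w)`, and a preferred chart has identity
derivative at its own base point. -/
theorem tangentProj_apply (w : TangentBundle 𝓘(ℝ, E) M) (Z : TangentSpace 𝓘(ℝ, E).tangent w) :
    tangentProj w Z = (Z : E × E).1 := by
  have hp : MDifferentiableAt 𝓘(ℝ, E).tangent 𝓘(ℝ, E)
      (fun w' : TangentBundle 𝓘(ℝ, E) M => w'.proj) w :=
    (contMDiff_proj (n := 1) (TangentSpace 𝓘(ℝ, E))).mdifferentiableAt one_ne_zero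
  have h0 : MDifferentiableAt 𝓘(ℝ, E) 𝓘(ℝ, E) (extChartAt 𝓘(ℝ, E) w.proj) w.proj :=
    mdifferentiableAt_extChartAt (mem_chart_source _ _)
  have h1 : MDifferentiableAt 𝓘(ℝ, E).tangent 𝓘(ℝ, E × E) (extChartAt 𝓘(ℝ, E).tangent w) w :=
    mdifferentiableAt_extChartAt (mem_chart_source _ _)
  have e1 := mfderiv_comp w h0 hp
  have h2 : MDifferentiableAt 𝓘(ℝ, E × E) 𝓘(ℝ, E) (Prod.fst : E × E → E)
      (extChartAt 𝓘(ℝ, E).tangent w w) := differentiableAt_fst.mdifferentiableAt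
  have e2 := mfderiv_comp w h2 h1
  rw [mfderiv_extChartAt_self] at e1 e2
  have e3 : (extChartAt 𝓘(ℝ, E) w.proj) ∘ (fun w' : TangentBundle 𝓘(ℝ, E) M => w'.proj)
     = Prod.fst ∘ (extChartAt 𝓘(ℝ, E).tangent w) := by
    ext w'
    simp only [Function.comp_apply, mfld_simps]
  rw [e3, e2, mfderiv_eq_fderiv, fderiv_fst] at e1
  exact (congrArg (fun l => l Z) e1).symm

/-- In charts `Tf` is `(y, a) ↦ (F y, DF(y) a)`, and the formula is its derivative by the product
rule. Smoothness of `F` is returned with it, for the symmetry of `D²F`. -/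
theorem mfderiv_tangentMap_eq {f : M → M'} (hf : ContMDiff 𝓘(ℝ, E) 𝓘(ℝ, E') ∞ f)
    (m : M) (a : E) {F : E → E'}
    (hF : F = chartAt E' (f m) ∘ f ∘ (chartAt E m).symm) (Z : E × E) :
    ContDiffAt ℝ ∞ F (chartAt E m m) ∧
    (mfderiv 𝓘(ℝ, E).tangent 𝓘(ℝ, E').tangent (tangentMap 𝓘(ℝ, E) 𝓘(ℝ, E') f) ⟨m, a⟩ Z : E' × E')
     = (fderiv ℝ F (chartAt E m m) Z.1,
          fderiv ℝ (fderiv ℝ F) (chartAt E m m) Z.1 a + fderiv ℝ F (chartAt E m m) Z.2) := by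
  set y := chartAt E m m with hy
  let p : TangentBundle 𝓘(ℝ, E) M := ⟨m, a⟩
  have hTf : ContMDiff 𝓘(ℝ, E).tangent 𝓘(ℝ, E').tangent ∞ (tangentMap 𝓘(ℝ, E) 𝓘(ℝ, E') f) :=
    hf.contMDiff_tangentMap (by simp)
  have hFy : ContDiffAt ℝ ∞ F y := by
    have := (contMDiffAt_iff.1 (hf m)).2
    simp only [mfld_simps, contDiffWithinAt_univ] at this
    rw [hF]; exact this
  have hpy : extChartAt 𝓘(ℝ, E).tangent p p = (y, a) := by
    rw [extChartAt_tangentBundle_apply (mem_chart_source _ _), mfderiv_extChartAt_self]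
    simp only [mfld_simps, hy]
    rfl
  have key : writtenInExtChartAt 𝓘(ℝ, E).tangent 𝓘(ℝ, E').tangent p (tangentMap 𝓘(ℝ, E) 𝓘(ℝ, E') f)
      =ᶠ[𝓝 ((y, a) : E × E)] fun q : E × E => ((F q.1, fderiv ℝ F q.1 q.2) : E' × E') := by
    have hc : ContinuousAt (fun q : E × E => f ((chartAt E m).symm q.1)) (y, a) := by
      refine ContinuousAt.comp (f := fun q : E × E => (chartAt E m).symm q.1)
        hf.continuous.continuousAt ?_
      exact ((chartAt E m).continuousAt_symm (mem_chart_target E m)).comp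
         (f := Prod.fst) continuousAt_fst
    have n1 : ∀ᶠ q : E × E in 𝓝 (y, a), q.1 ∈ (chartAt E m).target :=
      continuousAt_fst.eventually_mem ((chartAt E m).open_target.mem_nhds (mem_chart_target E m))
    have n2 : ∀ᶠ q : E × E in 𝓝 (y, a), f ((chartAt E m).symm q.1) ∈ (chartAt E' (f m)).source :=
      hc.eventually_mem ((chartAt E' (f m)).open_source.mem_nhds (by
        simp [hy, mem_chart_source]))
    filter_upwards [n1, n2] with q h1 h2
    have d1 : MDifferentiableAt 𝓘(ℝ, E) 𝓘(ℝ, E) (chartAt E m).symm q.1 :=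
      mdifferentiableAt_atlas_symm (chart_mem_atlas _ _) h1
    have d2 : MDifferentiableAt 𝓘(ℝ, E) 𝓘(ℝ, E') f ((chartAt E m).symm q.1) :=
      hf.mdifferentiableAt (by simp)
    have d3 : MDifferentiableAt 𝓘(ℝ, E') 𝓘(ℝ, E') (chartAt E' (f m)) (f ((chartAt E m).symm q.1)) :=
      mdifferentiableAt_atlas (chart_mem_atlas _ _) h2
    have e1 := mfderiv_comp q.1 d3 (d2.comp q.1 d1)
    rw [mfderiv_comp q.1 d2 d1, ← hF, mfderiv_eq_fderiv] at e1
    rw [writtenInExtChartAt, Function.comp_apply, Function.comp_apply,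
      extChartAt_tangentBundle_symm_apply h1, extChartAt_tangentBundle_apply h2]
    refine Prod.ext ?_ ?_
    · simp only [mfld_simps, hF]
      rfl
    · show _ = fderiv ℝ F q.1 q.2
      rw [e1]
      have h4 : (extChartAt 𝓘(ℝ, E') (f m) : M' → E') = chartAt E' (f m) := by
        simp only [mfld_simps]
      show (mfderiv 𝓘(ℝ, E') 𝓘(ℝ, E') (extChartAt 𝓘(ℝ, E') (f m)) _ _ : E') = _
      rw [h4]
      rfl
  refine ⟨hFy, ?_⟩
  rw [(hTf.mdifferentiableAt (by simp)).mfderiv]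
  have hr : range 𝓘(ℝ, E).tangent = univ := ModelWithCorners.range_eq_univ _
  rw [hr, fderivWithin_univ, hpy]
  have h1 : HasFDerivAt F (fderiv ℝ F y) y := (hFy.differentiableAt (by simp)).hasFDerivAt
  have h2 : HasFDerivAt (fderiv ℝ F) (fderiv ℝ (fderiv ℝ F) y) y :=
    ((hFy.fderiv_right (m := 1) (by norm_cast)).differentiableAt (by simp)).hasFDerivAt
  have h3 : HasFDerivAt (fun q : E × E => ((F q.1, fderiv ℝ F q.1 q.2) : E' × E')) _ (y, a) :=
    (h1.comp (y, a) hasFDerivAt_fst).prodMk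
      ((h2.comp (y, a) hasFDerivAt_fst).clm_apply hasFDerivAt_snd)
  refine (congrArg (fun l => l Z) (key.fderiv_eq.trans h3.fderiv)).trans ?_
  simp [add_comm]

theorem mfderiv_tangentMap_fst {f : M → M'} (hf : ContMDiff 𝓘(ℝ, E) 𝓘(ℝ, E') ∞ f)
    (m : M) (a : E) (Z : E × E) :
    (mfderiv 𝓘(ℝ, E).tangent 𝓘(ℝ, E').tangent (tangentMap 𝓘(ℝ, E) 𝓘(ℝ, E') f) ⟨m, a⟩ Z : E' × E').1 =
    mfderiv 𝓘(ℝ, E) 𝓘(ℝ, E') f m Z.1 := by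
  rw [(mfderiv_tangentMap_eq hf m a rfl Z).2, (hf.mdifferentiableAt (by simp)).mfderiv]
  simp only [mfld_simps, fderivWithin_univ, writtenInExtChartAt]
  rfl

/-- `T(Tf)` commutes with the canonical flip of the second tangent bundle, by symmetry of `D²F`. -/
theorem mfderiv_tangentMap_swap {f : M → M'} (hf : ContMDiff 𝓘(ℝ, E) 𝓘(ℝ, E') ∞ f)
    (m : M) (a b c : E) :
    (mfderiv 𝓘(ℝ, E).tangent 𝓘(ℝ, E').tangent (tangentMap 𝓘(ℝ, E) 𝓘(ℝ, E') f) ⟨m, a⟩ ((b, c) : E × E)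
      : E' × E').2 =
    (mfderiv 𝓘(ℝ, E).tangent 𝓘(ℝ, E').tangent (tangentMap 𝓘(ℝ, E) 𝓘(ℝ, E') f) ⟨m, b⟩ ((a, c) : E × E)
      : E' × E').2 := by
  obtain ⟨h, e1⟩ := mfderiv_tangentMap_eq hf m a rfl ((b, c) : E × E)
  rw [e1, (mfderiv_tangentMap_eq hf m b rfl ((a, c) : E × E)).2]
  have := h.isSymmSndFDerivAt (n := ∞) (by
    simpa only [minSmoothness_of_isRCLikeNormedField] using ENat.LEInfty.out)
  show _ + _ = _ + _
  rw [this b a]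

end Calculus

/-! ### Tangent maps depending on a parameter, and mixed partials -/

section Partials

/-- Both iterated partials are values of the symmetric form `D²f`, at `(u, 0)` and `(0, v)`. -/
theorem fderiv_fderiv_comm {X Y F : Type*} [NormedAddCommGroup X] [NormedSpace ℝ X]
    [NormedAddCommGroup Y] [NormedSpace ℝ Y] [NormedAddCommGroup F] [NormedSpace ℝ F]
    {f : X × Y → F} {x : X} {y : Y} (hf : ContDiffAt ℝ ∞ f (x, y)) (u : X) (v : Y) :
    fderiv ℝ (fun s => fderiv ℝ (fun t => f (s, t)) y v) x u
      = fderiv ℝ (fun t => fderiv ℝ (fun s => f (s, t)) x u) y v := by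
  have h2 : HasFDerivAt (fderiv ℝ f) (fderiv ℝ (fderiv ℝ f) (x, y)) (x, y) :=
    ((hf.fderiv_right (m := 1) (by norm_cast)).differentiableAt (by simp)).hasFDerivAt
  have hd : ∀ᶠ p in 𝓝 (x, y), DifferentiableAt ℝ f p :=
    ((hf.of_le (m := 1) (by norm_cast)).eventually (by simp)).mono
      fun p hp => hp.differentiableAt (by simp)
  have c1 : ContinuousAt (fun s : X => (s, y)) x := by fun_prop
  have c2 : ContinuousAt (fun t : Y => (x, t)) y := by fun_prop
  have e1 : (fun s => fderiv ℝ (fun t => f (s, t)) y v) =ᶠ[𝓝 x]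
      fun s => fderiv ℝ f (s, y) (0, v) := by
    filter_upwards [c1.eventually hd] with s hs
    have : HasFDerivAt (fun t => f (s, t)) _ y :=
      hs.hasFDerivAt.comp y (hasFDerivAt_prodMk_right s y)
    rw [this.fderiv]
    simp
  have e2 : (fun t => fderiv ℝ (fun s => f (s, t)) x u) =ᶠ[𝓝 y]
      fun t => fderiv ℝ f (x, t) (u, 0) := by
    filter_upwards [c2.eventually hd] with t ht
    have : HasFDerivAt (fun s => f (s, t)) _ x :=
      HasFDerivAt.comp (g := f) x ht.hasFDerivAt (hasFDerivAt_prodMk_left x t)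
    rw [this.fderiv]
    simp
  have d1 : HasFDerivAt (fun s => fderiv ℝ f (s, y) (0, v)) _ x :=
    (h2.comp x (hasFDerivAt_prodMk_left x y)).clm_apply (hasFDerivAt_const _ _)
  have d2 : HasFDerivAt (fun t => fderiv ℝ f (x, t) (u, 0)) _ y :=
    (h2.comp y (hasFDerivAt_prodMk_right x y)).clm_apply (hasFDerivAt_const _ _)
  rw [e1.fderiv_eq, e2.fderiv_eq, d1.fderiv, d2.fderiv]
  have := hf.isSymmSndFDerivAt (n := ∞) (by
    simpa only [minSmoothness_of_isRCLikeNormedField] using ENat.LEInfty.out)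
  simpa using this (u, 0) (0, v)

variable {EX : Type*} [NormedAddCommGroup EX] [NormedSpace ℝ EX]
  {X : Type*} [TopologicalSpace X] [ChartedSpace EX X] [IsManifold 𝓘(ℝ, EX) ∞ X]
  {E : Type*} [NormedAddCommGroup E] [NormedSpace ℝ E]
  {M : Type*} [TopologicalSpace M] [ChartedSpace E M] [IsManifold 𝓘(ℝ, E) ∞ M]
  {E' : Type*} [NormedAddCommGroup E'] [NormedSpace ℝ E']
  {N : Type*} [TopologicalSpace N] [ChartedSpace E' N] [IsManifold 𝓘(ℝ, E') ∞ N]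

/-- The zero section of `TX` embeds `X × TM` in `TX × TM = T(X × M)`, where the partial tangent map
is the restriction of `Tf`. -/
theorem contMDiff_tangentMap_uncurry {f : X × M → N}
    (hf : ContMDiff (𝓘(ℝ, EX).prod 𝓘(ℝ, E)) 𝓘(ℝ, E') ∞ f) :
    ContMDiff (𝓘(ℝ, EX).prod 𝓘(ℝ, E).tangent) 𝓘(ℝ, E').tangent ∞
      (fun p : X × TangentBundle 𝓘(ℝ, E) M =>
        tangentMap 𝓘(ℝ, E) 𝓘(ℝ, E') (fun m => f (p.1, m)) p.2) := by
  have h1 : ContMDiff (𝓘(ℝ, EX).prod 𝓘(ℝ, E).tangent) 𝓘(ℝ, EX).tangent ∞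
      (fun p : X × TangentBundle 𝓘(ℝ, E) M => (⟨p.1, 0⟩ : TangentBundle 𝓘(ℝ, EX) X)) :=
    (contMDiff_zeroSection ℝ (TangentSpace 𝓘(ℝ, EX))).comp contMDiff_fst
  have h2 := h1.prodMk (contMDiff_snd (I := 𝓘(ℝ, EX)) (J := 𝓘(ℝ, E).tangent) (M := X)
    (N := TangentBundle 𝓘(ℝ, E) M) (n := ∞))
  have h3 := (contMDiff_equivTangentBundleProd_symm (I := 𝓘(ℝ, EX)) (I' := 𝓘(ℝ, E)) (M := X)
    (M' := M) (n := ∞)).comp h2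
  have h4 := (hf.contMDiff_tangentMap (m := ∞) (by simp)).comp h3
  convert h4 using 1
  funext p
  obtain ⟨x, m, v⟩ := p
  refine TotalSpace.ext rfl (heq_of_eq ?_)
  simp only [Function.comp_apply, tangentMap]
  have := mfderiv_prod_eq_add_apply (hf.mdifferentiableAt (x := (x, m)) (by simp))
    (v := (show TangentSpace (𝓘(ℝ, EX).prod 𝓘(ℝ, E)) (x, m) from ((0 : EX), (show E from v))))
  refine Eq.trans ?_ this.symm
  have h0 : mfderiv 𝓘(ℝ, EX) 𝓘(ℝ, E') (fun z : X => f (z, m)) x (0 : EX) = 0 := map_zero _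
  exact ((congrArg (· + _) h0).trans (zero_add _)).symm

theorem mfderiv_tangentMap_param_snd {f : X × M → N}
    (hf : ContMDiff (𝓘(ℝ, EX).prod 𝓘(ℝ, E)) 𝓘(ℝ, E') ∞ f) (x : X) (m : M) (u : EX) (v : E)
    {F : EX × E → E'} (hF : F = fun p => chartAt E' (f (x, m)) (f ((chartAt EX x).symm p.1,
      (chartAt E m).symm p.2))) :
    ContDiffAt ℝ ∞ F (chartAt EX x x, chartAt E m m) ∧
    (mfderiv 𝓘(ℝ, EX) 𝓘(ℝ, E').tangent
      (fun x' => tangentMap 𝓘(ℝ, E) 𝓘(ℝ, E') (fun m => f (x', m)) ⟨m, v⟩) x u : E' × E').2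
    = fderiv ℝ (fun s => fderiv ℝ (fun t => F (s, t)) (chartAt E m m) v) (chartAt EX x x) u := by
  set y := chartAt E m m with hy
  set s0 := chartAt EX x x with hs0
  have hFy : ContDiffAt ℝ ∞ F (s0, y) := by
    have := (contMDiffAt_iff.1 (hf (x, m))).2
    simp only [mfld_simps, Prod.map_id, contDiffWithinAt_univ] at this
    rw [hF]
    exact this
  refine ⟨hFy, ?_⟩
  have hj : ContMDiff 𝓘(ℝ, EX) 𝓘(ℝ, E').tangent ∞
      (fun x' => tangentMap 𝓘(ℝ, E) 𝓘(ℝ, E') (fun m => f (x', m)) ⟨m, v⟩) :=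
    (contMDiff_tangentMap_uncurry hf).comp (contMDiff_id.prodMk contMDiff_const)
  have hc : ContinuousAt (fun s : EX => f ((chartAt EX x).symm s, m)) s0 := by
    refine ContinuousAt.comp (f := fun s : EX => ((chartAt EX x).symm s, m))
        hf.continuous.continuousAt ?_
    exact ((chartAt EX x).continuousAt_symm (mem_chart_target EX x)).prodMk continuousAt_const
  have n1 : ∀ᶠ s in 𝓝 s0, s ∈ (chartAt EX x).target :=
    (chartAt EX x).open_target.mem_nhds (mem_chart_target EX x)
  have n2 : ∀ᶠ s in 𝓝 s0, f ((chartAt EX x).symm s, m) ∈ (chartAt E' (f (x, m))).source :=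
    hc.eventually_mem ((chartAt E' (f (x, m))).open_source.mem_nhds (by
        simp [hs0, mem_chart_source]))
  have key : writtenInExtChartAt 𝓘(ℝ, EX) 𝓘(ℝ, E').tangent x
      (fun x' => tangentMap 𝓘(ℝ, E) 𝓘(ℝ, E') (fun m => f (x', m)) ⟨m, v⟩)
      =ᶠ[𝓝 s0] fun s => ((F (s, y), fderiv ℝ (fun t => F (s, t)) y v) : E' × E') := by
    filter_upwards [n1, n2] with s h1 h2
    have d1 : MDifferentiableAt 𝓘(ℝ, E) 𝓘(ℝ, E) (chartAt E m).symm y :=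
      mdifferentiableAt_atlas_symm (chart_mem_atlas _ _) (mem_chart_target E m)
    have hym : (chartAt E m).symm y = m := (chartAt E m).left_inv (mem_chart_source E m)
    have d2 : MDifferentiableAt 𝓘(ℝ, E) 𝓘(ℝ, E') (fun m => f ((chartAt EX x).symm s, m))
        ((chartAt E m).symm y) :=
      (hf.comp (contMDiff_const.prodMk contMDiff_id)).mdifferentiableAt (by simp)
    have d3 : MDifferentiableAt 𝓘(ℝ, E') 𝓘(ℝ, E') (chartAt E' (f (x, m)))
        (f ((chartAt EX x).symm s, ((chartAt E m).symm y))) :=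
      mdifferentiableAt_atlas (chart_mem_atlas _ _) (by rw [hym]; exact h2)
    have e1 := mfderiv_comp y d3 (d2.comp y d1)
    have hF' : (chartAt E' (f (x, m))) ∘ (fun m => f ((chartAt EX x).symm s, m)) ∘ (chartAt E m).symm
      = fun t => F (s, t) := by
      rw [hF]; rfl
    rw [mfderiv_comp y d2 d1, hF', mfderiv_eq_fderiv] at e1
    -- At the centre of the chart the coordinate vector and the tangent vector `v` are the same
    -- element of `E`.
    have e2 : mfderiv 𝓘(ℝ, E) 𝓘(ℝ, E) (chartAt E m).symm y = ContinuousLinearMap.id ℝ E := by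
      have := mfderivWithin_range_extChartAt_symm (I := 𝓘(ℝ, E)) (x := m)
      simp only [mfld_simps, mfderivWithin_univ] at this
      exact this
    rw [e2] at e1
    have e3 : fderiv ℝ (fun t => F (s, t)) y v =
        (mfderiv 𝓘(ℝ, E') 𝓘(ℝ, E') (chartAt E' (f (x, m)))
        (f ((chartAt EX x).symm s, (chartAt E m).symm y))
        (mfderiv 𝓘(ℝ, E) 𝓘(ℝ, E') (fun m => f ((chartAt EX x).symm s, m))
          ((chartAt E m).symm y) v) : E') := congrArg (fun l => l v) e1
    have h5 : (extChartAt 𝓘(ℝ, EX) x).symm s = (chartAt EX x).symm s := by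
      simp only [mfld_simps]
    have h4 : (extChartAt 𝓘(ℝ, E') (f (x, m)) : N → E') = chartAt E' (f (x, m)) := by
        simp only [mfld_simps]
    rw [writtenInExtChartAt, Function.comp_apply, Function.comp_apply, h5,
      extChartAt_tangentBundle_apply h2]
    refine Prod.ext ?_ ?_
    · show extChartAt 𝓘(ℝ, E') (f (x, m)) (f ((chartAt EX x).symm s, m)) = _
      rw [h4, hF]
      show _ = chartAt E' (f (x, m)) (f ((chartAt EX x).symm s, (chartAt E m).symm y))
      rw [hym]
    · show _ = fderiv ℝ (fun t => F (s, t)) y v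
      show (mfderiv 𝓘(ℝ, E') 𝓘(ℝ, E') (extChartAt 𝓘(ℝ, E') (f (x, m)))
        (f ((chartAt EX x).symm s, m))
        (mfderiv 𝓘(ℝ, E) 𝓘(ℝ, E') (fun m => f ((chartAt EX x).symm s, m)) m v) : E') = _
      rw [h4, e3, hym]
  rw [(hj.mdifferentiableAt (by simp)).mfderiv]
  have hr : range 𝓘(ℝ, EX) = univ := ModelWithCorners.range_eq_univ _
  have hx : extChartAt 𝓘(ℝ, EX) x x = s0 := by simp only [mfld_simps, hs0]
  rw [hr, fderivWithin_univ, hx, key.fderiv_eq]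
  have d1 : DifferentiableAt ℝ (fun s => F (s, y)) s0 := by
    have := (hFy.differentiableAt (by simp)).comp s0
      (f := fun s => (s, y)) (by fun_prop)
    exact this
  have d2 : DifferentiableAt ℝ (fun s => fderiv ℝ (fun t => F (s, t)) y v) s0 := by
    have h := hFy.fderiv_right (m := 1) (by norm_cast)
    have h2 : DifferentiableAt ℝ (fun s => fderiv ℝ F (s, y) (0, v)) s0 :=
      ((h.differentiableAt (by simp)).comp s0 (f := fun s => (s, y)) (by fun_prop)).clm_apply
        (differentiableAt_const _)
    have hd : ∀ᶠ p in 𝓝 (s0, y), DifferentiableAt ℝ F p :=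
      ((hFy.of_le (m := 1) (by norm_cast)).eventually (by simp)).mono
        fun p hp => hp.differentiableAt (by simp)
    have c1 : ContinuousAt (fun s : EX => (s, y)) s0 := by fun_prop
    refine h2.congr_of_eventuallyEq ?_
    filter_upwards [c1.eventually hd] with s hs
    have : HasFDerivAt (fun t => F (s, t)) _ y :=
      hs.hasFDerivAt.comp y (hasFDerivAt_prodMk_right s y)
    rw [this.fderiv]
    simp
  have := d1.fderiv_prodMk d2
  rw [this]
  rfl

/-- In charts the two sides are the two mixed partials. With `X = G` and `f` the action, one side
generates the action on `TM` and the other is the fibre part of a complete lift. -/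
theorem mfderiv_tangentMap_param_comm {f : X × M → N}
    (hf : ContMDiff (𝓘(ℝ, EX).prod 𝓘(ℝ, E)) 𝓘(ℝ, E') ∞ f) (x : X) (m : M) (u : EX) (v : E) :
    (mfderiv 𝓘(ℝ, EX) 𝓘(ℝ, E').tangent
      (fun x' => tangentMap 𝓘(ℝ, E) 𝓘(ℝ, E') (fun m => f (x', m)) ⟨m, v⟩) x u : E' × E').2
    = (mfderiv 𝓘(ℝ, E) 𝓘(ℝ, E').tangent
      (fun m' => tangentMap 𝓘(ℝ, EX) 𝓘(ℝ, E') (fun x => f (x, m')) ⟨x, u⟩) m v : E' × E').2 := by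
  obtain ⟨hF, e⟩ := mfderiv_tangentMap_param_snd hf x m u v rfl
  rw [e, (mfderiv_tangentMap_param_snd (f := fun p => f (p.2, p.1))
    (hf.comp (contMDiff_snd.prodMk contMDiff_fst)) m x v u rfl).2]
  exact fderiv_fderiv_comm hF u v

end Partials

/-! ### Vertical and complete lifts -/

section Lifts

variable {E : Type*} [NormedAddCommGroup E] [NormedSpace ℝ E]
  {M : Type*} [TopologicalSpace M] [ChartedSpace E M] [IsManifold 𝓘(ℝ, E) ∞ M]

theorem mfderiv_tangentBundle_fst {X : Type*} [NormedAddCommGroup X] [NormedSpace ℝ X]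
    {HX : Type*} [TopologicalSpace HX] {IX : ModelWithCorners ℝ X HX}
    {N : Type*} [TopologicalSpace N] [ChartedSpace HX N]
    {j : N → TangentBundle 𝓘(ℝ, E) M} {x : N}
    (hj : MDifferentiableAt IX 𝓘(ℝ, E).tangent j x) (u : TangentSpace IX x) :
    (mfderiv IX 𝓘(ℝ, E).tangent j x u : E × E).1
      = mfderiv IX 𝓘(ℝ, E) (fun x' => (j x').proj) x u := by
  have hp : MDifferentiableAt 𝓘(ℝ, E).tangent 𝓘(ℝ, E)
      (fun w' : TangentBundle 𝓘(ℝ, E) M => w'.proj) (j x) :=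
    (contMDiff_proj (n := 1) (TangentSpace 𝓘(ℝ, E))).mdifferentiableAt one_ne_zero
  have e := congrArg (fun l => l u) (mfderiv_comp x hp hj)
  exact (tangentProj_apply (j x) _).symm.trans e.symm

/-- The chart of `TM` over `m` is the identity on the fibre at `m`, so a straight line in that fibre
stays straight in coordinates. -/
theorem hasMFDerivAt_fibre (m : M) (w u : E) :
    HasMFDerivAt 𝓘(ℝ, ℝ) 𝓘(ℝ, E).tangent
      (fun s : ℝ => (⟨m, w + s • u⟩ : TangentBundle 𝓘(ℝ, E) M)) 0
      ((1 : ℝ →L[ℝ] ℝ).smulRight ((0 : E), u)) := by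
  have hc : Continuous (fun v : E => (⟨m, v⟩ : TangentBundle 𝓘(ℝ, E) M)) :=
    FiberBundle.continuous_totalSpaceMk E (TangentSpace 𝓘(ℝ, E)) m
  refine ⟨(hc.comp (by fun_prop : Continuous fun s : ℝ => w + s • u)).continuousAt, ?_⟩
  have key : writtenInExtChartAt 𝓘(ℝ, ℝ) 𝓘(ℝ, E).tangent 0
      (fun s : ℝ => (⟨m, w + s • u⟩ : TangentBundle 𝓘(ℝ, E) M))
      = fun s : ℝ => ((chartAt E m m, w + s • u) : E × E) := by
    funext s
    have e0 : (extChartAt 𝓘(ℝ, ℝ) (0 : ℝ)).symm s = s := by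
      rw [extChartAt_model_space_eq_id]; rfl
    rw [writtenInExtChartAt, Function.comp_apply, Function.comp_apply, e0]
    refine (extChartAt_tangentBundle_apply (p := (⟨m, w + (0 : ℝ) • u⟩ : TangentBundle 𝓘(ℝ, E) M))
      (q := ⟨m, w + s • u⟩) (mem_chart_source E m)).trans (Prod.ext ?_ ?_)
    · simp only [mfld_simps]
    · show (mfderiv 𝓘(ℝ, E) 𝓘(ℝ, E) (extChartAt 𝓘(ℝ, E) m) m _ : E) = w + s • u
      rw [mfderiv_extChartAt_self]
      rfl
  have h2 : HasDerivAt (fun s : ℝ => w + s • u) u 0 := by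
    simpa using ((hasDerivAt_id (0 : ℝ)).smul_const u).const_add w
  have h3 : HasDerivAt (fun s : ℝ => ((chartAt E m m, w + s • u) : E × E)) (0, u) 0 :=
    (hasDerivAt_const (0 : ℝ) _).prodMk h2
  rw [key]
  have h4 := h3.hasFDerivAt.hasFDerivWithinAt (s := range 𝓘(ℝ, ℝ))
  have h5 : extChartAt 𝓘(ℝ, ℝ) (0 : ℝ) 0 = 0 := by
    rw [extChartAt_model_space_eq_id]; rfl
  rw [h5]
  exact h4

theorem mfderiv_apply_vertical {f : TangentBundle 𝓘(ℝ, E) M → ℝ} {m : M} {w : E}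
    (hf : MDifferentiableAt 𝓘(ℝ, E).tangent 𝓘(ℝ, ℝ) f ⟨m, w⟩) (u : E) :
    mfderiv 𝓘(ℝ, E).tangent 𝓘(ℝ, ℝ) f ⟨m, w⟩ ((0 : E), u)
      = deriv (fun s : ℝ => f ⟨m, w + s • u⟩) 0 := by
  have h := hasMFDerivAt_fibre (M := M) m w u
  have hf' : MDifferentiableAt 𝓘(ℝ, E).tangent 𝓘(ℝ, ℝ) f
    ((fun s : ℝ => (⟨m, w + s • u⟩ : TangentBundle 𝓘(ℝ, E) M)) 0) := by
    simpa using hf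
  have h2 := congrArg (fun l => l (1 : ℝ)) (mfderiv_comp (0 : ℝ) hf' h.mdifferentiableAt)
  have h3 : mfderiv 𝓘(ℝ, ℝ) 𝓘(ℝ, E).tangent
      (fun s : ℝ => (⟨m, w + s • u⟩ : TangentBundle 𝓘(ℝ, E) M)) 0 (1 : ℝ) = ((0 : E), u) := by
    rw [h.mfderiv]
    exact one_smul ℝ ((0 : E), u)
  have h4 : deriv (fun s : ℝ => f ⟨m, w + s • u⟩) 0 = mfderiv 𝓘(ℝ, E).tangent 𝓘(ℝ, ℝ) f
      ⟨m, w + (0 : ℝ) • u⟩ ((0 : E), u) := by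
    refine Eq.trans ?_ (h2.trans ?_)
    · rw [mfderiv_eq_fderiv]; exact fderiv_apply_one_eq_deriv.symm
    · exact congrArg _ h3
  rw [h4]
  have e0 : w = w + (0 : ℝ) • u := by
    rw [zero_smul, add_zero]
  exact congrArg (fun a : E => (mfderiv 𝓘(ℝ, E).tangent 𝓘(ℝ, ℝ) f
      (⟨m, a⟩ : TangentBundle 𝓘(ℝ, E) M) ((0 : E), u) : ℝ)) e0

/-- The complete lift is natural under diffeomorphism-related vector fields. -/
theorem completeLift_related {f : M → M} (hf : ContMDiff 𝓘(ℝ, E) 𝓘(ℝ, E) ∞ f)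
    {Z Z' : ∀ m : M, TangentSpace 𝓘(ℝ, E) m} (w : TangentBundle 𝓘(ℝ, E) M)
    (hZ : MDifferentiableAt 𝓘(ℝ, E) 𝓘(ℝ, E).tangent
      (fun m : M => (⟨m, Z m⟩ : TangentBundle 𝓘(ℝ, E) M)) w.proj)
    (hZ' : MDifferentiableAt 𝓘(ℝ, E) 𝓘(ℝ, E).tangent
      (fun m : M => (⟨m, Z' m⟩ : TangentBundle 𝓘(ℝ, E) M)) (f w.proj))
    (h : ∀ m, Z' (f m) = mfderiv 𝓘(ℝ, E) 𝓘(ℝ, E) f m (Z m)) :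
    completeLift Z' (tangentMap 𝓘(ℝ, E) 𝓘(ℝ, E) f w)
      = mfderiv 𝓘(ℝ, E).tangent 𝓘(ℝ, E).tangent (tangentMap 𝓘(ℝ, E) 𝓘(ℝ, E) f) w
        (completeLift Z w) := by
  obtain ⟨m, w⟩ := w
  have hTf : ContMDiff 𝓘(ℝ, E).tangent 𝓘(ℝ, E).tangent ∞ (tangentMap 𝓘(ℝ, E) 𝓘(ℝ, E) f) :=
    hf.contMDiff_tangentMap (by simp)
  refine Prod.ext ?_ ?_
  · exact (h m).trans (mfderiv_tangentMap_fst hf m w (completeLift Z ⟨m, w⟩)).symm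
  -- Relatedness says `Z' ∘ f = Tf ∘ Z` as maps into `TM`; differentiating both sides along `w`
  -- gives the fibre components up to a flip.
  · have e : (fun m => (⟨f m, Z' (f m)⟩ : TangentBundle 𝓘(ℝ, E) M)) =
        fun m => tangentMap 𝓘(ℝ, E) 𝓘(ℝ, E) f ⟨m, Z m⟩ := by
      funext m; rw [h]; rfl
    have e1 := congrArg (fun l => l w)
      (mfderiv_comp m hZ' (hf.mdifferentiableAt (x := m) (by simp)))
    have e2 := congrArg (fun l => l w) (mfderiv_comp m (hTf.mdifferentiableAt (by simp)) hZ)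
    have e3 : (mfderiv 𝓘(ℝ, E) 𝓘(ℝ, E).tangent
        (fun m => (⟨f m, Z' (f m)⟩ : TangentBundle 𝓘(ℝ, E) M)) m w : E × E) =
      mfderiv 𝓘(ℝ, E) 𝓘(ℝ, E).tangent (fun m => tangentMap 𝓘(ℝ, E) 𝓘(ℝ, E) f ⟨m, Z m⟩) m w := by
      rw [e]; rfl
    have e4 := (e1.symm.trans e3).trans e2
    refine (congrArg Prod.snd e4).trans ?_
    have hZ1 : (mfderiv 𝓘(ℝ, E) 𝓘(ℝ, E).tangent
        (fun m => (⟨m, Z m⟩ : TangentBundle 𝓘(ℝ, E) M)) m w : E × E).1 = w := by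
      refine (mfderiv_tangentBundle_fst hZ w).trans ?_
      exact congrArg (fun l => l w) (mfderiv_id (I := 𝓘(ℝ, E)) (x := m))
    -- The chain rule differentiates `Tf` at `Z m` in direction `(w, ·)`, whereas the complete lift
    -- needs it at `w` in direction `(Z m, ·)`.
    have hs := mfderiv_tangentMap_swap hf m (Z m) w (mfderiv 𝓘(ℝ, E) 𝓘(ℝ, E).tangent
        (fun m => (⟨m, Z m⟩ : TangentBundle 𝓘(ℝ, E) M)) m w : E × E).2
    refine Eq.trans ?_ hs
    nth_rw 2 [← hZ1]
    rfl

end Lifts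

/-! ### A chain rule with transportable base point -/

section BaseChange

variable {F : Type*} [NormedAddCommGroup F] [NormedSpace ℝ F]
  {H : Type*} [TopologicalSpace H] {I : ModelWithCorners ℝ F H}
  {N : Type*} [TopologicalSpace N] [ChartedSpace H N]
  {F' : Type*} [NormedAddCommGroup F'] [NormedSpace ℝ F']
  {H' : Type*} [TopologicalSpace H'] {I' : ModelWithCorners ℝ F' H'}
  {N' : Type*} [TopologicalSpace N'] [ChartedSpace H' N']
  {F'' : Type*} [NormedAddCommGroup F''] [NormedSpace ℝ F'']
  {H'' : Type*} [TopologicalSpace H''] {I'' : ModelWithCorners ℝ F'' H''}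
  {N'' : Type*} [TopologicalSpace N''] [ChartedSpace H'' N'']

/-- The chain rule, with the base point of the outer derivative given up to equality. -/
theorem mfderiv_comp_apply_of_eq {f : N → N'} {k : N' → N''} {x : N} {y : N'} (h : f x = y)
    (hk : MDifferentiableAt I' I'' k y) (hf : MDifferentiableAt I I' f x) (v : F) :
    (mfderiv I I'' (fun x => k (f x)) x v : F'') = mfderiv I' I'' k y (mfderiv I I' f x v : F') := by
  subst h
  exact congrArg (fun l => l v) (mfderiv_comp x hk hf)

end BaseChange

/-! ### Generators of a smooth action and curves moved by it -/

section Action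

variable {EG : Type*} [NormedAddCommGroup EG] [NormedSpace ℝ EG]
  {G : Type*} [TopologicalSpace G] [ChartedSpace EG G] [Group G]
  {F : Type*} [NormedAddCommGroup F] [NormedSpace ℝ F]
  {H : Type*} [TopologicalSpace H] (I : ModelWithCorners ℝ F H)
  {N : Type*} [TopologicalSpace N] [ChartedSpace H N] [MulAction G N]
  [ContMDiffSMul 𝓘(ℝ, EG) I ∞ G N]

/-- The derivative at the identity of the orbit map through `n`, in the direction `ξ`. -/
noncomputable def orbitDeriv (n : N) : GroupLieAlgebra 𝓘(ℝ, EG) G →L[ℝ] TangentSpace I n :=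
  mfderiv 𝓘(ℝ, EG) I (fun h : G => h • n) 1

theorem mdifferentiableAt_smul_const (h : G) (n : N) :
    MDifferentiableAt 𝓘(ℝ, EG) I (fun x : G => x • n) h :=
  (ContMDiff.smul (I := 𝓘(ℝ, EG)) (I' := I) (n := ∞) contMDiff_id
    contMDiff_const).mdifferentiableAt (by simp)

theorem mdifferentiableAt_const_smul (EG : Type*) [NormedAddCommGroup EG] [NormedSpace ℝ EG]
    [ChartedSpace EG G] [ContMDiffSMul 𝓘(ℝ, EG) I ∞ G N] (h : G) (n : N) :
    MDifferentiableAt I I (fun n : N => h • n) n :=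
  (ContMDiff.smul (I := 𝓘(ℝ, EG)) (I' := I) (n := ∞) contMDiff_const
    contMDiff_id).mdifferentiableAt (by simp)

variable [LieGroup 𝓘(ℝ, EG) ∞ G]

theorem mdifferentiableAt_conj (h : G) (x : G) :
    MDifferentiableAt 𝓘(ℝ, EG) 𝓘(ℝ, EG) (fun x : G => h * x * h⁻¹) x :=
  ((contMDiff_const.mul (contMDiff_id (n := ∞))).mul contMDiff_const).mdifferentiableAt (by simp)

/-- The infinitesimal generators of an action are related through the adjoint action. -/
theorem mfderiv_smul_orbitDeriv (h : G) (n : N) (ξ : GroupLieAlgebra 𝓘(ℝ, EG) G) :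
    (mfderiv I I (fun n : N => h • n) n (orbitDeriv I n ξ) : F) = orbitDeriv I (h • n) (Ad h ξ) := by
  have e1 := mfderiv_comp_apply_of_eq (I := 𝓘(ℝ, EG)) (I' := I) (I'' := I)
    (f := fun x : G => x • n) (k := fun n : N => h • n) (one_smul G n)
    (mdifferentiableAt_const_smul I EG h n) (mdifferentiableAt_smul_const I 1 n) ξ
  have e2 := mfderiv_comp_apply_of_eq (I := 𝓘(ℝ, EG)) (I' := 𝓘(ℝ, EG)) (I'' := I)
    (f := fun x : G => h * x * h⁻¹) (k := fun x : G => x • (h • n)) (x := 1) (y := 1) (by simp)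
    (mdifferentiableAt_smul_const I _ (h • n)) (mdifferentiableAt_conj h 1) ξ
  -- Differentiating this identity at `x = 1` is the whole proof.
  have e3 : (fun x : G => h • x • n) = fun x : G => (h * x * h⁻¹) • h • n := by
    funext x; simp [mul_smul]
  refine e1.symm.trans (Eq.trans ?_ e2)
  rw [e3]; rfl

/-- Factor `x • n = h • (h⁻¹ x) • n` and differentiate at `x = h`: the inner orbit map is then
evaluated at `1`, on the Maurer-Cartan image of `X`. -/
theorem mfderiv_orbit_eq_maurerCartan (h : G) (n : N) (X : TangentSpace 𝓘(ℝ, EG) h) :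
    (mfderiv 𝓘(ℝ, EG) I (fun x : G => x • n) h X : F)
      = mfderiv I I (fun n : N => h • n) n (orbitDeriv I n (maurerCartan h X)) := by
  have hm : MDifferentiableAt 𝓘(ℝ, EG) 𝓘(ℝ, EG) (fun x : G => h⁻¹ * x) h :=
    (contMDiff_const.mul (contMDiff_id (n := ∞))).mdifferentiableAt (by simp)
  have d1 := mdifferentiableAt_smul_const (EG := EG) I (1 : G) n
  have e2 := mfderiv_comp_apply_of_eq (I := 𝓘(ℝ, EG)) (I' := 𝓘(ℝ, EG)) (I'' := I)
    (f := fun x : G => h⁻¹ * x) (k := fun x : G => x • n) (x := h) (y := 1) (by simp) d1 hm X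
  have d2 : MDifferentiableAt 𝓘(ℝ, EG) I (fun x : G => (h⁻¹ * x) • n) h := by
    refine MDifferentiableAt.comp h (g := fun x : G => x • n) ?_ hm
    exact mdifferentiableAt_smul_const I _ n
  have e1 := mfderiv_comp_apply_of_eq (I := 𝓘(ℝ, EG)) (I' := I) (I'' := I)
    (f := fun x : G => (h⁻¹ * x) • n) (k := fun n : N => h • n) (x := h) (y := n) (by simp)
    (mdifferentiableAt_const_smul I EG h n) d2 X
  have e3 : (fun x : G => h • (h⁻¹ * x) • n) = fun x : G => x • n := by
    funext x; simp [mul_smul]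
  have e4 : (mfderiv 𝓘(ℝ, EG) I (fun x : G => h • (h⁻¹ * x) • n) h X : F)
    = mfderiv 𝓘(ℝ, EG) I (fun x : G => x • n) h X := by
    rw [e3]; rfl
  refine e4.symm.trans (e1.trans ?_)
  exact congrArg (fun v : F => (mfderiv I I (fun n : N => h • n) n v : F)) e2

/-- The velocity of `t ↦ h(t) • n(t)`. -/
theorem hasMFDerivAt_smul_curve {h : ℝ → G} {n : ℝ → N} {t : ℝ}
    (hh : MDifferentiableAt 𝓘(ℝ, ℝ) 𝓘(ℝ, EG) h t) (hn : MDifferentiableAt 𝓘(ℝ, ℝ) I n t) :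
    MDifferentiableAt 𝓘(ℝ, ℝ) I (fun s => h s • n s) t ∧
    (velocity I (fun s => h s • n s) t : F) = mfderiv I I (fun n : N => h t • n) (n t)
      (velocity I n t + orbitDeriv I (n t) (maurerCartan (h t) (velocity 𝓘(ℝ, EG) h t))) := by
  have hs : MDifferentiableAt (𝓘(ℝ, EG).prod I) I (fun p : G × N => p.1 • p.2) (h t, n t) :=
    (contMDiff_smul (I := 𝓘(ℝ, EG)) (I' := I) (n := ∞)).mdifferentiableAt (by simp)
  have hp : MDifferentiableAt 𝓘(ℝ, ℝ) (𝓘(ℝ, EG).prod I) (fun s => (h s, n s)) t := hh.prodMk hn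
  refine ⟨MDifferentiableAt.comp t hs hp, ?_⟩
  have e1 := mfderiv_comp_apply_of_eq (f := fun s => (h s, n s)) (x := t) rfl hs hp (1 : ℝ)
  refine e1.trans ?_
  have e2 : (mfderiv 𝓘(ℝ, ℝ) (𝓘(ℝ, EG).prod I) (fun s => (h s, n s)) t (1 : ℝ) : EG × F)
     = ((velocity 𝓘(ℝ, EG) h t : EG), (velocity I n t : F)) := by
    rw [MDifferentiableAt.mfderiv_prod hh hn]; rfl
  rw [e2]
  refine (mfderiv_prod_eq_add_apply hs).trans ?_
  refine Eq.trans ?_ (map_add _ _ _).symm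
  refine (add_comm _ _).trans ?_
  exact congrArg (fun v => _ + v) (mfderiv_orbit_eq_maurerCartan I (h t) (n t) _)

/-- The orbit maps of a smooth free action are immersions. -/
theorem orbitDeriv_injective [CompleteSpace EG] [BoundarylessManifold I N] [IsManifold I ∞ N]
    (hfree : ∀ (h : G) (n : N), h • n = n → h = 1) (n : N) :
    Function.Injective (orbitDeriv (EG := EG) (G := G) I n) := by
  have : LieGroup 𝓘(ℝ, EG) (minSmoothness ℝ 3) G :=
    LieGroup.of_le (n := ∞) (by
      simp only [minSmoothness_of_isRCLikeNormedField]; exact ENat.LEInfty.out)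
  have : IsManifold 𝓘(ℝ, EG) ∞ G := inferInstance
  have : IsManifold 𝓘(ℝ, EG) 1 G := inferInstance
  refine (injective_iff_map_eq_zero _).2 fun ξ hξ => ?_
  have hv : ContMDiffAt 𝓘(ℝ, EG) 𝓘(ℝ, EG).tangent 1
    (fun g : G => (mulInvariantVectorField ξ g : TangentBundle 𝓘(ℝ, EG) G)) 1 :=
    (contMDiff_mulInvariantVectorField ξ).contMDiffAt.of_le (by
      simp only [minSmoothness_of_isRCLikeNormedField]; exact one_le_two)
  -- A local integral curve of the left-invariant field of `ξ` serves as the one-parameter subgroup.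
  obtain ⟨γ, hγ0, hγ⟩ := exists_isMIntegralCurveAt_of_contMDiffAt_boundaryless
    (I := 𝓘(ℝ, EG)) (0 : ℝ) hv
  -- As `(γ t · x) • n = γ t • (x • n)`, the velocity of `γ t • n` is the translate of the generator
  -- at `n`, which is zero.
  have hx : IsMIntegralCurveAt (I := I) (fun t => γ t • n) (fun _ => 0) 0 := by
    filter_upwards [hγ] with t ht
    have hc := HasMFDerivAt.comp t (mdifferentiableAt_smul_const (EG := EG) I (γ t) n).hasMFDerivAt ht
    have hz : (mfderiv 𝓘(ℝ, EG) I (fun x : G => x • n) (γ t) (mulInvariantVectorField ξ (γ t)) : F)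
        = 0 := by
      have hm : MDifferentiableAt 𝓘(ℝ, EG) 𝓘(ℝ, EG) (fun x : G => γ t * x) 1 :=
        (contMDiff_const.mul (contMDiff_id (n := ∞))).mdifferentiableAt (by simp)
      have e1 := mfderiv_comp_apply_of_eq (mul_one (γ t))
        (mdifferentiableAt_smul_const (EG := EG) I (γ t) n) hm ξ
      have e2 := mfderiv_comp_apply_of_eq (I := 𝓘(ℝ, EG)) (I' := I) (I'' := I)
        (f := fun x : G => x • n) (k := fun n : N => γ t • n) (one_smul G n)
        (mdifferentiableAt_const_smul I EG (γ t) n) (mdifferentiableAt_smul_const I 1 n) ξ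
      have e3 : (fun x : G => (γ t * x) • n) = fun x : G => γ t • x • n := by
        funext x; rw [mul_smul]
      refine e1.symm.trans (Eq.trans ?_ (e2.trans ?_))
      · rw [e3]; rfl
      · exact (congrArg (fun v : F => (mfderiv I I (fun n : N => γ t • n) n v : F)) hξ).trans
          (map_zero _)
    refine hc.congr_mfderiv ?_
    refine ContinuousLinearMap.ext_ring ?_
    have h1 : (1 : ℝ) • (mulInvariantVectorField ξ (γ t) : EG) = mulInvariantVectorField ξ (γ t) :=
      one_smul ℝ (mulInvariantVectorField ξ (γ t) : EG)
    refine (congrArg (fun v : EG => (mfderiv 𝓘(ℝ, EG) I (fun x : G => x • n) (γ t) v : F)) h1).trans ?_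
    exact hz.trans (smul_zero (1 : ℝ)).symm
  have hy : IsMIntegralCurveAt (I := I) (fun _ : ℝ => n) (fun _ => 0) 0 := by
    refine Eventually.of_forall fun t => ?_
    refine (hasMFDerivAt_const n t).congr_mfderiv ?_
    refine ContinuousLinearMap.ext_ring ?_
    exact (smul_zero (1 : ℝ)).symm
  have hzero : ContMDiff I I.tangent 1 (fun x : N => (⟨x, 0⟩ : TangentBundle I N)) :=
    contMDiff_zeroSection ℝ (TangentSpace I)
  -- Uniqueness of integral curves of the zero field makes `γ t • n` locally constant; freeness then
  -- makes `γ` itself locally constant, so `ξ = 0`.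
  have heq := isMIntegralCurveAt_eventuallyEq_of_contMDiffAt_boundaryless (I := I)
    (hzero _) hx hy (by simp [hγ0])
  have hγ1 : γ =ᶠ[𝓝 0] fun _ => 1 := heq.mono fun t ht => hfree _ _ ht
  have h1 := hγ.hasMFDerivAt
  have h2 : HasMFDerivAt 𝓘(ℝ, ℝ) 𝓘(ℝ, EG) γ 0 _ :=
    (hasMFDerivAt_const (1 : G) (0 : ℝ)).congr_of_eventuallyEq hγ1
  have h3 := congrArg (fun l => l (1 : ℝ)) (hasMFDerivAt_unique h1 h2)
  have h4 : (mulInvariantVectorField ξ (1 : G) : EG) = 0 := by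
    have h5 : (1 : ℝ) • (mulInvariantVectorField ξ (γ 0) : EG) = 0 := h3
    rw [one_smul, hγ0] at h5
    exact h5
  have h6 : (fun x : G => 1 * x) = id := by funext x; simp
  rw [mulInvariantVectorField, h6] at h4
  refine Eq.trans ?_ h4
  exact (congrArg (fun l => l ξ) (mfderiv_id (I := 𝓘(ℝ, EG)) (x := (1 : G)))).symm

end Action

/-! ### The adjoint action and the isotropy of `μ` -/

section Adjoint

variable {EG : Type*} [NormedAddCommGroup EG] [NormedSpace ℝ EG]
  {G : Type*} [TopologicalSpace G] [ChartedSpace EG G] [Group G]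

theorem Ad_neg (h : G) (ξ : GroupLieAlgebra 𝓘(ℝ, EG) G) : Ad h (-ξ) = -Ad h ξ :=
  map_neg (mfderiv 𝓘(ℝ, EG) 𝓘(ℝ, EG) (fun x : G => h * x * h⁻¹) 1) ξ

theorem Ad_one (ξ : GroupLieAlgebra 𝓘(ℝ, EG) G) : Ad (1 : G) ξ = ξ := by
  have h : (fun x : G => 1 * x * 1⁻¹) = id := by funext x; simp
  rw [Ad, h]
  exact congrArg (fun l => l ξ) (mfderiv_id (I := 𝓘(ℝ, EG)) (x := (1 : G)))

theorem one_mem_isotropyGroup {μ : Module.Dual ℝ (GroupLieAlgebra 𝓘(ℝ, EG) G)} :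
    (1 : G) ∈ isotropyGroup μ := fun ξ => by rw [Ad_one]

variable [LieGroup 𝓘(ℝ, EG) ∞ G]

theorem Ad_mul (h k : G) (ξ : GroupLieAlgebra 𝓘(ℝ, EG) G) : Ad (h * k) ξ = Ad h (Ad k ξ) := by
  have e := mfderiv_comp_apply_of_eq (I := 𝓘(ℝ, EG)) (I' := 𝓘(ℝ, EG)) (I'' := 𝓘(ℝ, EG))
    (f := fun x : G => k * x * k⁻¹) (k := fun x : G => h * x * h⁻¹) (x := 1) (y := 1) (by simp)
    (mdifferentiableAt_conj h 1) (mdifferentiableAt_conj k 1) ξ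
  have h1 : (fun x : G => h * k * x * (h * k)⁻¹) = fun x => h * (k * x * k⁻¹) * h⁻¹ := by
    funext x; group
  refine Eq.trans ?_ e
  rw [Ad, h1]; rfl

theorem Ad_inv_Ad (h : G) (ξ : GroupLieAlgebra 𝓘(ℝ, EG) G) : Ad h⁻¹ (Ad h ξ) = ξ := by
  rw [← Ad_mul, inv_mul_cancel, Ad_one]

theorem Ad_Ad_inv (h : G) (ξ : GroupLieAlgebra 𝓘(ℝ, EG) G) : Ad h (Ad h⁻¹ ξ) = ξ := by
  rw [← Ad_mul, mul_inv_cancel, Ad_one]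

/-- Conjugation is a homomorphism: differentiate `h(xy)h⁻¹ = (hxh⁻¹)(hyh⁻¹)` in `y` at `1`. -/
theorem mfderiv_conj_mulInvariantVectorField (h x : G) (ξ : GroupLieAlgebra 𝓘(ℝ, EG) G) :
    (mfderiv 𝓘(ℝ, EG) 𝓘(ℝ, EG) (fun x : G => h * x * h⁻¹) x (mulInvariantVectorField ξ x) : EG)
      = mulInvariantVectorField (Ad h ξ) (h * x * h⁻¹) := by
  have hm : ∀ g y : G, MDifferentiableAt 𝓘(ℝ, EG) 𝓘(ℝ, EG) (fun x : G => g * x) y := fun g y =>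
    (contMDiff_const.mul (contMDiff_id (n := ∞))).mdifferentiableAt (by simp)
  have e1 := mfderiv_comp_apply_of_eq (mul_one x) (mdifferentiableAt_conj (EG := EG) h x) (hm x 1) ξ
  have e2 := mfderiv_comp_apply_of_eq (I := 𝓘(ℝ, EG)) (I' := 𝓘(ℝ, EG)) (I'' := 𝓘(ℝ, EG))
    (f := fun x : G => h * x * h⁻¹) (k := fun y => (h * x * h⁻¹) * y) (x := 1) (y := 1) (by simp)
    (hm _ 1) (mdifferentiableAt_conj h 1) ξ
  have e3 : (fun y : G => h * (x * y) * h⁻¹) = fun y => (h * x * h⁻¹) * (h * y * h⁻¹) := by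
    funext y; group
  refine e1.symm.trans (Eq.trans ?_ e2)
  rw [e3]; rfl

/-- Conjugation by `h⁻¹` supplies the inverse. Invertibility gives meaning to the pullback of vector
fields, which inverts the derivative. -/
theorem isInvertible_mfderiv_conj (h x : G) :
    (mfderiv 𝓘(ℝ, EG) 𝓘(ℝ, EG) (fun x : G => h * x * h⁻¹) x).IsInvertible := by
  refine ContinuousLinearMap.IsInvertible.of_inverse
    (g := mfderiv 𝓘(ℝ, EG) 𝓘(ℝ, EG) (fun x : G => h⁻¹ * x * h⁻¹⁻¹) (h * x * h⁻¹)) ?_ ?_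
  · ext v
    have e := mfderiv_comp_apply_of_eq (I := 𝓘(ℝ, EG)) (I' := 𝓘(ℝ, EG)) (I'' := 𝓘(ℝ, EG))
      (f := fun x : G => h⁻¹ * x * h⁻¹⁻¹) (k := fun x => h * x * h⁻¹) (x := h * x * h⁻¹) (y := x)
      (by group) (mdifferentiableAt_conj h x) (mdifferentiableAt_conj h⁻¹ _) v
    have h1 : (fun x : G => h * (h⁻¹ * x * h⁻¹⁻¹) * h⁻¹) = id := by funext x; simp; group
    rw [h1, mfderiv_id] at e
    exact e.symm
  · ext v
    have e := mfderiv_comp_apply_of_eq (I := 𝓘(ℝ, EG)) (I' := 𝓘(ℝ, EG)) (I'' := 𝓘(ℝ, EG))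
      (k := fun x : G => h⁻¹ * x * h⁻¹⁻¹) (f := fun x => h * x * h⁻¹) (x := x) (y := h * x * h⁻¹)
      rfl (mdifferentiableAt_conj h⁻¹ _) (mdifferentiableAt_conj h x)  v
    have h1 : (fun x : G => h⁻¹ * (h * x * h⁻¹) * h⁻¹⁻¹) = id := by funext x; simp; group
    rw [h1, mfderiv_id] at e
    exact e.symm

/-- The adjoint action preserves the Lie bracket. -/
theorem Ad_lie [CompleteSpace EG] (h : G) (ξ η : GroupLieAlgebra 𝓘(ℝ, EG) G) :
    Ad h ⁅ξ, η⁆ = ⁅Ad h ξ, Ad h η⁆ := by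
  have : LieGroup 𝓘(ℝ, EG) (minSmoothness ℝ 3) G :=
    LieGroup.of_le (n := ∞) (by
      simp only [minSmoothness_of_isRCLikeNormedField]; exact ENat.LEInfty.out)
  have hp : ∀ ζ : GroupLieAlgebra 𝓘(ℝ, EG) G,
      VectorField.mpullback 𝓘(ℝ, EG) 𝓘(ℝ, EG) (fun x : G => h * x * h⁻¹)
        (mulInvariantVectorField (Ad h ζ)) = mulInvariantVectorField ζ := fun ζ => by
    funext x
    rw [VectorField.mpullback_apply,
      (isInvertible_mfderiv_conj h x).inverse_apply_eq]
    exact (mfderiv_conj_mulInvariantVectorField h x ζ).symm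
  have hc : ContMDiff 𝓘(ℝ, EG) 𝓘(ℝ, EG) ∞ (fun x : G => h * x * h⁻¹) :=
    (contMDiff_const.mul contMDiff_id).mul contMDiff_const
  have key := VectorField.mpullback_mlieBracket (x₀ := (1 : G)) (n := ∞)
    (mdifferentiableAt_mulInvariantVectorField (Ad h ξ))
    (mdifferentiableAt_mulInvariantVectorField (Ad h η)) hc.contMDiffAt (by
      simp only [minSmoothness_of_isRCLikeNormedField]; exact ENat.LEInfty.out)
  rw [hp, hp, VectorField.mpullback_apply, (isInvertible_mfderiv_conj h 1).inverse_apply_eq] at key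
  refine key.symm.trans ?_
  -- The pulled-back bracket sits at `h * 1 * h⁻¹`, which is only propositionally `1`; generalizing
  -- the field allows transport of the base point.
  have h1 : h * 1 * h⁻¹ = 1 := by simp
  rw [GroupLieAlgebra.bracket_def]
  generalize VectorField.mlieBracket 𝓘(ℝ, EG) (mulInvariantVectorField (Ad h ξ))
    (mulInvariantVectorField (Ad h η)) = V
  have : ∀ x y : G, x = y → (V x : EG) = V y := fun x y h => by subst h; rfl
  exact this _ _ h1

variable {μ : Module.Dual ℝ (GroupLieAlgebra 𝓘(ℝ, EG) G)}

theorem mul_mem_isotropyGroup {h k : G} (hh : h ∈ isotropyGroup μ) (hk : k ∈ isotropyGroup μ) :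
    h * k ∈ isotropyGroup μ := fun ξ => by rw [Ad_mul, hh, hk]

theorem inv_mem_isotropyGroup {h : G} (hh : h ∈ isotropyGroup μ) :
    h⁻¹ ∈ isotropyGroup μ := fun ξ => by rw [← hh, Ad_Ad_inv]

/-- `μ[Ad h ξ, η] = μ(Ad h [ξ, Ad h⁻¹ η]) = μ[ξ, Ad h⁻¹ η] = 0`. -/
theorem Ad_mem_isotropyAlgebra [FiniteDimensional ℝ EG] {h : G} (hh : h ∈ isotropyGroup μ)
    {ξ : GroupLieAlgebra 𝓘(ℝ, EG) G} (hξ : ξ ∈ isotropyAlgebra μ) :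
    Ad h ξ ∈ isotropyAlgebra μ := by
  have : CompleteSpace EG := FiniteDimensional.complete ℝ EG
  intro η
  rw [← Ad_Ad_inv h η, ← Ad_lie, hh]
  exact hξ _

end Adjoint

/-! ### The induced action on `TM` and its generators -/

section TangentAction

variable {E : Type*} [NormedAddCommGroup E] [NormedSpace ℝ E]
  {M : Type*} [TopologicalSpace M] [ChartedSpace E M]
  {EG : Type*} [NormedAddCommGroup EG] [NormedSpace ℝ EG]
  {G : Type*} [Group G] [MulAction G M]

theorem tangentAction_one (w : TangentBundle 𝓘(ℝ, E) M) : tangentAction (1 : G) w = w := by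
  have : (fun m : M => (1 : G) • m) = id := by funext m; simp
  rw [tangentAction, this, tangentMap_id]; rfl

variable [TopologicalSpace G] [ChartedSpace EG G]

/-- Views a fundamental field as a tangent map in `G` with parameter in `M`, so that the results on
parametrized tangent maps apply. -/
theorem fund_section_eq (ξ : GroupLieAlgebra 𝓘(ℝ, EG) G) :
    (fun m : M => (⟨m, fund m ξ⟩ : TangentBundle 𝓘(ℝ, E) M)) =
      fun m' => tangentMap 𝓘(ℝ, EG) 𝓘(ℝ, E) (fun x : G => x • m') ⟨1, ξ⟩ := by
  funext m
  have : ∀ (x y : M) (v : E), x = y →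
    (⟨x, v⟩ : TangentBundle 𝓘(ℝ, E) M) = ⟨y, v⟩ := fun x y v h => by subst h; rfl
  exact this _ _ _ (one_smul G m).symm

variable [ContMDiffSMul 𝓘(ℝ, EG) 𝓘(ℝ, E) ∞ G M]

include EG in
theorem tangentAction_mul (h k : G) (w : TangentBundle 𝓘(ℝ, E) M) :
    tangentAction (h * k) w = tangentAction h (tangentAction k w) := by
  have d : ∀ h : G, MDifferentiable 𝓘(ℝ, E) 𝓘(ℝ, E) (fun m : M => h • m) := fun h m =>
    mdifferentiableAt_const_smul 𝓘(ℝ, E) EG h m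
  have h1 : (fun m : M => (h * k) • m) = (fun m : M => h • m) ∘ fun m => k • m := by
    funext m; simp [mul_smul]
  rw [tangentAction, h1, tangentMap_comp (d h) (d k)]; rfl

variable (E M EG G) in
/-- The induced action of `G` on `TM`. -/
noncomputable abbrev tangentMulAction : MulAction G (TangentBundle 𝓘(ℝ, E) M) where
  smul := tangentAction
  one_smul := tangentAction_one
  mul_smul := tangentAction_mul (EG := EG)

variable [IsManifold 𝓘(ℝ, E) ∞ M]

variable (M EG G) in
theorem contMDiff_tangentAction_uncurry [IsManifold 𝓘(ℝ, EG) ∞ G] :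
    ContMDiff (𝓘(ℝ, EG).prod 𝓘(ℝ, E).tangent) 𝓘(ℝ, E).tangent ∞
      (fun p : G × TangentBundle 𝓘(ℝ, E) M => tangentAction p.1 p.2) :=
  contMDiff_tangentMap_uncurry (f := fun p : G × M => p.1 • p.2)
    (contMDiff_smul (I := 𝓘(ℝ, EG)) (I' := 𝓘(ℝ, E)))

include EG in
theorem contMDiff_tangentAction (h : G) :
    ContMDiff 𝓘(ℝ, E).tangent 𝓘(ℝ, E).tangent ∞
      (tangentAction h : TangentBundle 𝓘(ℝ, E) M → _) :=
  (ContMDiffSMul.contMDiff_const_smul (I := 𝓘(ℝ, EG)) (n := ∞) h).contMDiff_tangentMap (by simp)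

variable [LieGroup 𝓘(ℝ, EG) ∞ G]

/-- The complete lift of a fundamental field generates the induced action on `TM`. -/
theorem fundC_eq_mfderiv (ξ : GroupLieAlgebra 𝓘(ℝ, EG) G) (w : TangentBundle 𝓘(ℝ, E) M) :
    (fundC ξ w : E × E) = mfderiv 𝓘(ℝ, EG) 𝓘(ℝ, E).tangent (fun h : G => tangentAction h w) 1 ξ := by
  have hj : MDifferentiableAt 𝓘(ℝ, EG) 𝓘(ℝ, E).tangent (fun h : G => tangentAction h w) 1 :=
    ((contMDiff_tangentAction_uncurry M EG G).comp
      (contMDiff_id.prodMk contMDiff_const)).mdifferentiableAt (by simp)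
  refine Prod.ext (mfderiv_tangentBundle_fst hj ξ).symm ?_
  -- Differentiating first in `M` along `w` and then in `G` along `ξ` may be done in the other
  -- order, which is the definition of the complete lift.
  refine Eq.trans ?_ (mfderiv_tangentMap_param_comm (f := fun p : G × M => p.1 • p.2)
    (contMDiff_smul (I := 𝓘(ℝ, EG)) (I' := 𝓘(ℝ, E))) 1 w.proj ξ w.snd).symm
  rw [fundC, completeLift, fund_section_eq]
  rfl

theorem contMDiff_fund (ξ : GroupLieAlgebra 𝓘(ℝ, EG) G) :
    ContMDiff 𝓘(ℝ, E) 𝓘(ℝ, E).tangent ∞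
      (fun m : M => (⟨m, fund m ξ⟩ : TangentBundle 𝓘(ℝ, E) M)) := by
  rw [fund_section_eq]
  have h : ContMDiff 𝓘(ℝ, E) (𝓘(ℝ, E).prod 𝓘(ℝ, EG).tangent) ∞
      (fun m : M => (m, (⟨1, ξ⟩ : TangentBundle 𝓘(ℝ, EG) G))) :=
    contMDiff_id.prodMk contMDiff_const
  exact (contMDiff_tangentMap_uncurry (f := fun p : M × G => p.2 • p.1)
    ((contMDiff_smul (I := 𝓘(ℝ, EG)) (I' := 𝓘(ℝ, E))).comp
      (contMDiff_snd.prodMk contMDiff_fst))).comp h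

/-- The fundamental fields on `TM` are related through the adjoint action. -/
theorem mfderiv_tangentAction_fundC (h : G) (ξ : GroupLieAlgebra 𝓘(ℝ, EG) G)
    (w : TangentBundle 𝓘(ℝ, E) M) :
    (mfderiv 𝓘(ℝ, E).tangent 𝓘(ℝ, E).tangent (tangentAction h) w (fundC ξ w) : E × E)
      = fundC (Ad h ξ) (tangentAction h w) := by
  let _ := tangentMulAction E M EG G
  have : ContMDiffSMul 𝓘(ℝ, EG) 𝓘(ℝ, E).tangent ∞ G (TangentBundle 𝓘(ℝ, E) M) :=
    ⟨contMDiff_tangentAction_uncurry M EG G⟩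
  have e := mfderiv_smul_orbitDeriv 𝓘(ℝ, E).tangent h w ξ
  refine Eq.trans ?_ (e.trans (fundC_eq_mfderiv _ _).symm)
  exact congrArg (fun v : E × E => (mfderiv 𝓘(ℝ, E).tangent 𝓘(ℝ, E).tangent (tangentAction h) w v
    : E × E)) (fundC_eq_mfderiv _ _)

/-- The product rule for a smooth action, applied to `G` acting on `TM`, whose generators are the
complete lifts. -/
theorem velocity_tangentAction {h : ℝ → G} {n : ℝ → TangentBundle 𝓘(ℝ, E) M} {t : ℝ}
    (hh : MDifferentiableAt 𝓘(ℝ, ℝ) 𝓘(ℝ, EG) h t)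
    (hn : MDifferentiableAt 𝓘(ℝ, ℝ) 𝓘(ℝ, E).tangent n t) :
    MDifferentiableAt 𝓘(ℝ, ℝ) 𝓘(ℝ, E).tangent (fun s => tangentAction (h s) (n s)) t ∧
    (velocity 𝓘(ℝ, E).tangent (fun s => tangentAction (h s) (n s)) t : E × E)
      = mfderiv 𝓘(ℝ, E).tangent 𝓘(ℝ, E).tangent (tangentAction (h t)) (n t)
      (velocity 𝓘(ℝ, E).tangent n t + fundC (maurerCartan (h t) (velocity 𝓘(ℝ, EG) h t)) (n t)) := by
  let _ := tangentMulAction E M EG G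
  have : ContMDiffSMul 𝓘(ℝ, EG) 𝓘(ℝ, E).tangent ∞ G (TangentBundle 𝓘(ℝ, E) M) :=
    ⟨contMDiff_tangentAction_uncurry M EG G⟩
  obtain ⟨d, e⟩ := hasMFDerivAt_smul_curve 𝓘(ℝ, E).tangent hh hn
  refine ⟨d, e.trans ?_⟩
  exact congrArg (fun v : TangentSpace 𝓘(ℝ, E).tangent (n t) =>
    (mfderiv 𝓘(ℝ, E).tangent 𝓘(ℝ, E).tangent (tangentAction (h t)) (n t) (velocity 𝓘(ℝ, E).tangent n t + v) : E × E)) (fundC_eq_mfderiv _ _).symm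

theorem fund_injective [CompleteSpace EG] (hfree : ∀ (h : G) (m : M), h • m = m → h = 1) (m : M) :
    Function.Injective
      (fund m : GroupLieAlgebra 𝓘(ℝ, EG) G →L[ℝ] TangentSpace 𝓘(ℝ, E) m) :=
  orbitDeriv_injective (EG := EG) (G := G) (N := M) 𝓘(ℝ, E) hfree m

end TangentAction

/-! ### Simple mechanical Lagrangians -/

section Metric

variable {E : Type*} [NormedAddCommGroup E] [NormedSpace ℝ E]
  {M : Type*} [TopologicalSpace M] [ChartedSpace E M] [IsManifold 𝓘(ℝ, E) ∞ M]
  (g : ContMDiffRiemannianMetric 𝓘(ℝ, E) ∞ E (fun m : M => TangentSpace 𝓘(ℝ, E) m))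

theorem metric_definite {m : M} {u : TangentSpace 𝓘(ℝ, E) m} (h : g.inner m u u = 0) : u = 0 := by
  by_contra hu
  exact (g.pos m u hu).ne' h

theorem contMDiffAt_metric {Z : ∀ m : M, TangentSpace 𝓘(ℝ, E) m} {w : TangentBundle 𝓘(ℝ, E) M}
    (hZ : ContMDiffAt 𝓘(ℝ, E) 𝓘(ℝ, E).tangent ∞
      (fun m : M => (⟨m, Z m⟩ : TangentBundle 𝓘(ℝ, E) M)) w.proj) :
    ContMDiffAt 𝓘(ℝ, E).tangent 𝓘(ℝ, ℝ) ∞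
      (fun w : TangentBundle 𝓘(ℝ, E) M => g.inner w.proj w.snd (Z w.proj)) w := by
  have hp : ContMDiff 𝓘(ℝ, E).tangent 𝓘(ℝ, E) ∞ (fun w : TangentBundle 𝓘(ℝ, E) M => w.proj) :=
    contMDiff_proj _
  have h1 : ContMDiffAt 𝓘(ℝ, E).tangent (𝓘(ℝ, E).prod 𝓘(ℝ)) ∞
      (fun w : TangentBundle 𝓘(ℝ, E) M => TotalSpace.mk' ℝ (E := Bundle.Trivial M ℝ) w.proj
        (g.inner w.proj w.snd (Z w.proj))) w := by
    apply ContMDiffAt.clm_bundle_apply₂ (F₁ := E) (F₂ := E)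
    · exact g.contMDiff.contMDiffAt.comp w hp.contMDiffAt
    · exact contMDiffAt_id
    · exact hZ.comp w hp.contMDiffAt
  simp only [contMDiffAt_totalSpace] at h1
  exact h1.2

variable {V : M → ℝ}

/-- On a line in a fibre `L` is a quadratic polynomial whose linear coefficient is `g(w, u)`; the
potential is constant there. -/
theorem fibreDeriv_simpleLagrangian (w : TangentBundle 𝓘(ℝ, E) M)
    (u : TangentSpace 𝓘(ℝ, E) w.proj) :
    fibreDeriv (simpleLagrangian g V) w u = g.inner w.proj w.snd u := by
  have h : (fun s : ℝ => simpleLagrangian g V ⟨w.proj, w.snd + s • u⟩) = fun s : ℝ =>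
      (1 / 2 * g.inner w.proj w.snd w.snd - V w.proj) + s * g.inner w.proj w.snd u +
        s ^ 2 * (1 / 2 * g.inner w.proj u u) := by
    funext s
    simp only [simpleLagrangian, map_add, map_smul, add_apply, smul_apply, smul_eq_mul,
      g.symm w.proj u w.snd]
    ring
  rw [fibreDeriv, h]
  have h1 := (((hasDerivAt_id (0 : ℝ)).mul_const (g.inner w.proj w.snd u)).const_add
    (1 / 2 * g.inner w.proj w.snd w.snd - V w.proj)).add
    (((hasDerivAt_id (0 : ℝ)).pow 2).mul_const (1 / 2 * g.inner w.proj u u))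
  refine h1.deriv.trans ?_
  simp

theorem hessian_simpleLagrangian (w : TangentBundle 𝓘(ℝ, E) M)
    (u v : TangentSpace 𝓘(ℝ, E) w.proj) :
    hessian (simpleLagrangian g V) w u v = g.inner w.proj u v := by
  have h : (fun s : ℝ => fibreDeriv (simpleLagrangian g V) ⟨w.proj, w.snd + s • u⟩ v) =
      fun s : ℝ => g.inner w.proj w.snd v + s * g.inner w.proj u v := by
    funext s
    rw [fibreDeriv_simpleLagrangian]
    simp only [map_add, map_smul, add_apply, smul_apply, smul_eq_mul]
  rw [hessian, h]
  refine (((hasDerivAt_id (0 : ℝ)).mul_const (g.inner w.proj u v)).const_add _).deriv.trans ?_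
  simp

variable {g} in
theorem contMDiff_simpleLagrangian (hV : ContMDiff 𝓘(ℝ, E) 𝓘(ℝ, ℝ) ∞ V) :
    ContMDiff 𝓘(ℝ, E).tangent 𝓘(ℝ, ℝ) ∞ (simpleLagrangian g V) := by
  intro w
  have hp : ContMDiff 𝓘(ℝ, E).tangent 𝓘(ℝ, E) ∞ (fun w : TangentBundle 𝓘(ℝ, E) M => w.proj) :=
    contMDiff_proj _
  have h1 : ContMDiffAt 𝓘(ℝ, E).tangent (𝓘(ℝ, E).prod 𝓘(ℝ)) ∞
      (fun w : TangentBundle 𝓘(ℝ, E) M => TotalSpace.mk' ℝ (E := Bundle.Trivial M ℝ) w.proj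
        (g.inner w.proj w.snd w.snd)) w := by
    apply ContMDiffAt.clm_bundle_apply₂ (F₁ := E) (F₂ := E)
    · exact g.contMDiff.contMDiffAt.comp w hp.contMDiffAt
    · exact contMDiffAt_id
    · exact contMDiffAt_id
  simp only [contMDiffAt_totalSpace] at h1
  exact (contMDiffAt_const.mul h1.2).sub (hV.contMDiffAt.comp w hp.contMDiffAt)

/-- A tangent vector satisfying the Euler-Lagrange equations at a point is determined by them. -/
theorem eulerLagrange_unique (w : TangentBundle 𝓘(ℝ, E) M) (X Y : TangentSpace 𝓘(ℝ, E).tangent w)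
    (hXY : tangentProj w X = tangentProj w Y)
    (h : ∀ Z : ∀ m : M, TangentSpace 𝓘(ℝ, E) m,
      ContMDiffAt 𝓘(ℝ, E) 𝓘(ℝ, E).tangent ∞
        (fun m : M => (⟨m, Z m⟩ : TangentBundle 𝓘(ℝ, E) M)) w.proj →
      mfderiv 𝓘(ℝ, E).tangent 𝓘(ℝ, ℝ)
        (fun w' : TangentBundle 𝓘(ℝ, E) M => fibreDeriv (simpleLagrangian g V) w' (Z w'.proj)) w X =
      mfderiv 𝓘(ℝ, E).tangent 𝓘(ℝ, ℝ)
        (fun w' : TangentBundle 𝓘(ℝ, E) M => fibreDeriv (simpleLagrangian g V) w' (Z w'.proj)) w Y) :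
    X = Y := by
  obtain ⟨m, w⟩ := w
  rw [tangentProj_apply, tangentProj_apply] at hXY
  obtain ⟨a, x⟩ := X
  obtain ⟨b, y⟩ := Y
  obtain rfl : a = b := hXY
  -- The difference of the two vectors is vertical, say the lift of `u`. Testing with a local
  -- extension `Z` of `u` gives `g(u, u) = 0`, because the vertical derivative of `Z^V(L)` is the
  -- Hessian.
  have hu : (x - y : E) = 0 := by
    set u : TangentSpace 𝓘(ℝ, E) m := (x - y : E) with hu
    set Z : ∀ m : M, TangentSpace 𝓘(ℝ, E) m := FiberBundle.extend E u with hZdef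
    have hZ : ContMDiffAt 𝓘(ℝ, E) 𝓘(ℝ, E).tangent ∞
        (fun m : M => (⟨m, Z m⟩ : TangentBundle 𝓘(ℝ, E) M)) m :=
      FiberBundle.contMDiffAt_extend 𝓘(ℝ, E) E u
    have hZm : Z m = u := FiberBundle.extend_apply_self E u
    have hd : MDifferentiableAt 𝓘(ℝ, E).tangent 𝓘(ℝ, ℝ) (fun w' : TangentBundle 𝓘(ℝ, E) M =>
        fibreDeriv (simpleLagrangian g V) w' (Z w'.proj)) ⟨m, w⟩ := by
      simp only [fibreDeriv_simpleLagrangian]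
      exact (contMDiffAt_metric g (w := ⟨m, w⟩) hZ).mdifferentiableAt (by simp)
    have h1 := h Z hZ
    have h2 := mfderiv_apply_vertical hd (x - y)
    have h3 : deriv (fun s : ℝ => fibreDeriv (simpleLagrangian g V)
        (⟨m, w + s • u⟩ : TangentBundle 𝓘(ℝ, E) M) (Z m)) 0 = g.inner m u (Z m) :=
      hessian_simpleLagrangian g ⟨m, w⟩ u (Z m)
    have h4 : ((0, x - y) : E × E) = (a, x) - (a, y) := by simp
    refine metric_definite g (m := m) ?_
    have h5 := h2.symm.trans ((congrArg (fun v : E × E => (mfderiv 𝓘(ℝ, E).tangent 𝓘(ℝ, ℝ)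
        (fun w' : TangentBundle 𝓘(ℝ, E) M =>
        fibreDeriv (simpleLagrangian g V) w' (Z w'.proj)) ⟨m, w⟩ v : ℝ)) h4).trans
      ((map_sub _ _ _).trans (sub_eq_zero.2 h1)))
    have h6 := h3.symm.trans h5
    rw [hZm] at h6
    exact h6
  exact Prod.ext rfl (sub_eq_zero.1 hu)

end Metric

/-! ### Invariance of the Euler-Lagrange field and conservation of momentum -/

section Invariance

variable {E : Type*} [NormedAddCommGroup E] [NormedSpace ℝ E]
  {M : Type*} [TopologicalSpace M] [ChartedSpace E M] [IsManifold 𝓘(ℝ, E) ∞ M]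
  {EG : Type*} [NormedAddCommGroup EG] [NormedSpace ℝ EG]
  {G : Type*} [Group G] [MulAction G M]
  {g : ContMDiffRiemannianMetric 𝓘(ℝ, E) ∞ E (fun m : M => TangentSpace 𝓘(ℝ, E) m)}
  {V : M → ℝ}

variable (G) in
/-- The metric is invariant under the action. -/
def InvariantMetric
    (g : ContMDiffRiemannianMetric 𝓘(ℝ, E) ∞ E (fun m : M => TangentSpace 𝓘(ℝ, E) m)) : Prop :=
  ∀ (h : G) (m : M) (u v : TangentSpace 𝓘(ℝ, E) m),
      g.inner (h • m) (mfderiv 𝓘(ℝ, E) 𝓘(ℝ, E) (fun x : M => h • x) m u)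
        (mfderiv 𝓘(ℝ, E) 𝓘(ℝ, E) (fun x : M => h • x) m v) = g.inner m u v

theorem simpleLagrangian_tangentAction (hg : InvariantMetric G g)
    (hVinv : ∀ (h : G) (m : M), V (h • m) = V m) (h : G) (w : TangentBundle 𝓘(ℝ, E) M) :
    simpleLagrangian g V (tangentAction h w) = simpleLagrangian g V w := by
  have h1 := hg h w.proj w.snd w.snd
  have h2 := hVinv h w.proj
  exact congrArg₂ (fun a b : ℝ => 1 / 2 * a - b) h1 h2

variable [TopologicalSpace G] [ChartedSpace EG G] [ContMDiffSMul 𝓘(ℝ, EG) 𝓘(ℝ, E) ∞ G M]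

include EG in
-- Translations are isometries, so the adjoint of the derivative of `h` is the derivative of `h⁻¹`.
theorem inner_smul_eq (hg : InvariantMetric G g) (h : G) (m : M) (u : TangentSpace 𝓘(ℝ, E) m)
    (v : TangentSpace 𝓘(ℝ, E) (h • m)) :
    g.inner (h • m) (mfderiv 𝓘(ℝ, E) 𝓘(ℝ, E) (fun x : M => h • x) m u) v =
      g.inner m u (mfderiv 𝓘(ℝ, E) 𝓘(ℝ, E) (fun x : M => h⁻¹ • x) (h • m) v : E) := by
  refine Eq.trans ?_ (hg h m u _)
  have e := mfderiv_comp_apply_of_eq (f := fun x : M => h⁻¹ • x) (k := fun x : M => h • x)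
    (x := h • m) (y := m) (by simp) (mdifferentiableAt_const_smul 𝓘(ℝ, E) EG h m)
    (mdifferentiableAt_const_smul 𝓘(ℝ, E) EG h⁻¹ _) v
  have h1 : (fun x : M => h • h⁻¹ • x) = id := by funext x; simp
  rw [h1, mfderiv_id] at e
  exact congrArg (fun v : E => (g.inner (h • m)
    (mfderiv 𝓘(ℝ, E) 𝓘(ℝ, E) (fun x : M => h • x) m u) v : ℝ)) e

include EG in
/-- The Euler-Lagrange field of an invariant Lagrangian is invariant. -/
theorem eulerLagrangeField_tangentAction (hg : InvariantMetric G g)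
    (hV : ContMDiff 𝓘(ℝ, E) 𝓘(ℝ, ℝ) ∞ V) (hVinv : ∀ (h : G) (m : M), V (h • m) = V m)
    {Γ : ∀ w : TangentBundle 𝓘(ℝ, E) M, TangentSpace 𝓘(ℝ, E).tangent w}
    (hΓ : IsEulerLagrangeField (simpleLagrangian g V) Γ) (h : G) (w : TangentBundle 𝓘(ℝ, E) M) :
    Γ (tangentAction h w)
      = mfderiv 𝓘(ℝ, E).tangent 𝓘(ℝ, E).tangent (tangentAction h) w (Γ w) := by
  have hs : ∀ h : G, ContMDiff 𝓘(ℝ, E) 𝓘(ℝ, E) ∞ (fun m : M => h • m) := fun h =>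
    ContMDiffSMul.contMDiff_const_smul (I := 𝓘(ℝ, EG)) h
  have hT : ∀ h : G, ContMDiff 𝓘(ℝ, E).tangent 𝓘(ℝ, E).tangent ∞
      (tangentAction h : TangentBundle 𝓘(ℝ, E) M → _) := contMDiff_tangentAction (EG := EG)
  obtain ⟨m, w⟩ := w
  refine eulerLagrange_unique g (V := V) _ _ _ ?_ fun Z' hZ' => ?_
  · rw [hΓ.secondOrder, tangentProj_apply]
    refine Eq.trans ?_ (mfderiv_tangentMap_fst (hs h) m w _).symm
    have := hΓ.secondOrder ⟨m, w⟩
    rw [tangentProj_apply] at this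
    exact (congrArg (fun v : E => (mfderiv 𝓘(ℝ, E) 𝓘(ℝ, E) (fun x : M => h • x) m v : E)) this).symm
  -- The test field `Z'` at the translated point is pulled back by `h`. The Euler-Lagrange equation
  -- for `Z` at the original point then matches the one for `Z'`, term by term.
  · let Z : ∀ x : M, TangentSpace 𝓘(ℝ, E) x := fun x =>
      (mfderiv 𝓘(ℝ, E) 𝓘(ℝ, E) (fun x : M => h⁻¹ • x) (h • x) (Z' (h • x)) : E)
    have hZeq : (fun x : M => (⟨x, Z x⟩ : TangentBundle 𝓘(ℝ, E) M)) =
        fun x => tangentAction h⁻¹ ⟨h • x, Z' (h • x)⟩ := by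
      funext x
      have : ∀ (x y : M) (v : E), x = y →
        (⟨x, v⟩ : TangentBundle 𝓘(ℝ, E) M) = ⟨y, v⟩ := fun x y v h => by subst h; rfl
      exact this _ _ _ (by simp)
    have hZ : ContMDiffAt 𝓘(ℝ, E) 𝓘(ℝ, E).tangent ∞
        (fun x : M => (⟨x, Z x⟩ : TangentBundle 𝓘(ℝ, E) M)) m := by
      rw [hZeq]
      exact ((hT h⁻¹).contMDiffAt).comp m
        (ContMDiffAt.comp (g := fun x : M => (⟨x, Z' x⟩ : TangentBundle 𝓘(ℝ, E) M)) m hZ' (hs h m))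
    have hrel : ∀ x, Z' (h • x) = mfderiv 𝓘(ℝ, E) 𝓘(ℝ, E) (fun x : M => h • x) x (Z x) := by
      intro x
      have e := mfderiv_comp_apply_of_eq (f := fun x : M => h⁻¹ • x) (k := fun x : M => h • x)
        (x := h • x) (y := x) (by simp) ((hs h).mdifferentiableAt (by simp))
        ((hs h⁻¹).mdifferentiableAt (by simp)) (Z' (h • x))
      have h1 : (fun x : M => h • h⁻¹ • x) = id := by funext x; simp
      rw [h1, mfderiv_id] at e
      exact e
    have d1 : MDifferentiableAt 𝓘(ℝ, E).tangent 𝓘(ℝ, ℝ) (fun w' : TangentBundle 𝓘(ℝ, E) M =>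
        fibreDeriv (simpleLagrangian g V) w' (Z' w'.proj)) (tangentAction h ⟨m, w⟩) := by
      simp only [fibreDeriv_simpleLagrangian]
      exact (contMDiffAt_metric g (w := tangentAction h ⟨m, w⟩) hZ').mdifferentiableAt (by simp)
    have dL : ∀ w, MDifferentiableAt 𝓘(ℝ, E).tangent 𝓘(ℝ, ℝ) (simpleLagrangian g V) w := fun w =>
      (contMDiff_simpleLagrangian hV).mdifferentiableAt (by simp)
    rw [hΓ.eulerLagrange Z' _ hZ']
    have hcl := completeLift_related (hs h) ⟨m, w⟩ (hZ.mdifferentiableAt (by simp))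
      (hZ'.mdifferentiableAt (by simp)) hrel
    have e1 := mfderiv_comp_apply_of_eq (x := (⟨m, w⟩ : TangentBundle 𝓘(ℝ, E) M)) rfl
      (dL (tangentAction h ⟨m, w⟩)) ((hT h).mdifferentiableAt (by simp)) (completeLift Z ⟨m, w⟩)
    have e2 := mfderiv_comp_apply_of_eq (x := (⟨m, w⟩ : TangentBundle 𝓘(ℝ, E) M)) rfl
      d1 ((hT h).mdifferentiableAt (by simp)) (Γ ⟨m, w⟩)
    have f1 : (fun w : TangentBundle 𝓘(ℝ, E) M => simpleLagrangian g V (tangentAction h w)) =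
        simpleLagrangian g V := funext fun w => simpleLagrangian_tangentAction hg hVinv h w
    have f2 : (fun w : TangentBundle 𝓘(ℝ, E) M => fibreDeriv (simpleLagrangian g V)
        (tangentAction h w) (Z' (tangentAction h w).proj)) =
        fun w => fibreDeriv (simpleLagrangian g V) w (Z w.proj) := by
      funext w
      rw [fibreDeriv_simpleLagrangian, fibreDeriv_simpleLagrangian]
      exact inner_smul_eq (EG := EG) hg h w.proj w.snd (Z' (h • w.proj))
    have e3 := hΓ.eulerLagrange Z ⟨m, w⟩ hZ
    rw [f1] at e1
    rw [f2] at e2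
    have e4 := congrArg (fun v : E × E => (mfderiv 𝓘(ℝ, E).tangent 𝓘(ℝ, ℝ)
      (simpleLagrangian g V) (tangentAction h ⟨m, w⟩) v : ℝ)) hcl
    exact (e4.trans e1.symm).trans (e3.symm.trans e2)

variable [LieGroup 𝓘(ℝ, EG) ∞ G]

/-- `f` is constant along the orbit map through `w`, whose derivative at `1` is the complete lift.
-/
theorem mfderiv_fundC_eq_zero {f : TangentBundle 𝓘(ℝ, E) M → ℝ} {w : TangentBundle 𝓘(ℝ, E) M}
    (hf : MDifferentiableAt 𝓘(ℝ, E).tangent 𝓘(ℝ, ℝ) f w)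
    (hinv : ∀ (h : G), f (tangentAction h w) = f w) (ξ : GroupLieAlgebra 𝓘(ℝ, EG) G) :
    mfderiv 𝓘(ℝ, E).tangent 𝓘(ℝ, ℝ) f w (fundC ξ w) = 0 := by
  have hj : MDifferentiableAt 𝓘(ℝ, EG) 𝓘(ℝ, E).tangent (fun h : G => tangentAction h w) 1 :=
    ((contMDiff_tangentAction_uncurry M EG G).comp
      (contMDiff_id.prodMk contMDiff_const)).mdifferentiableAt (by simp)
  have e := mfderiv_comp_apply_of_eq (f := fun h : G => tangentAction h w) (tangentAction_one w) hf hj ξ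
  have e2 : (fun h : G => f (tangentAction h w)) = fun _ => f w := by
    funext h; exact hinv h
  have e3 : (mfderiv 𝓘(ℝ, EG) 𝓘(ℝ, ℝ) (fun h : G => f (tangentAction h w)) 1 ξ : ℝ) = 0 := by
    rw [e2, mfderiv_const]; rfl
  refine Eq.trans ?_ (e.symm.trans e3)
  exact congrArg (fun v : E × E => (mfderiv 𝓘(ℝ, E).tangent 𝓘(ℝ, ℝ) f w v : ℝ)) (fundC_eq_mfderiv ξ w)

/-- Noether's theorem: the Euler-Lagrange equation for `Z = ξ̃` reads `Γ(p_ξ) = ξ̃^C(L)`, which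
vanishes by invariance of `L`. -/
theorem eulerLagrangeField_mem_levelTangent (hg : InvariantMetric G g)
    (hV : ContMDiff 𝓘(ℝ, E) 𝓘(ℝ, ℝ) ∞ V) (hVinv : ∀ (h : G) (m : M), V (h • m) = V m)
    {Γ : ∀ w : TangentBundle 𝓘(ℝ, E) M, TangentSpace 𝓘(ℝ, E).tangent w}
    (hΓ : IsEulerLagrangeField (simpleLagrangian g V) Γ) (w : TangentBundle 𝓘(ℝ, E) M) :
    Γ w ∈ levelTangent EG G (simpleLagrangian g V) w := by
  refine (Submodule.mem_iInf _).2 fun ξ => ?_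
  have h1 := hΓ.eulerLagrange (fun m => fund m ξ) w (contMDiff_fund ξ _)
  have h2 := mfderiv_fundC_eq_zero (f := simpleLagrangian g V) (w := w)
    ((contMDiff_simpleLagrangian hV).mdifferentiableAt (by simp))
    (fun h => simpleLagrangian_tangentAction hg hVinv h w) ξ
  exact h1.trans h2

/-- Equivariance of the momentum map, which makes `G_μ` preserve `N_μ`. -/
theorem inner_smul_fund (hg : InvariantMetric G g) (h : G) (m : M) (u : TangentSpace 𝓘(ℝ, E) m)
    (η : GroupLieAlgebra 𝓘(ℝ, EG) G) :
    g.inner (h • m) (mfderiv 𝓘(ℝ, E) 𝓘(ℝ, E) (fun x : M => h • x) m u) (fund (h • m) η) =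
      g.inner m u (fund m (Ad h⁻¹ η)) := by
  have e := mfderiv_smul_orbitDeriv 𝓘(ℝ, E) h m (Ad h⁻¹ η)
  rw [Ad_Ad_inv] at e
  rw [← hg h m u]
  exact congrArg _ e.symm

theorem tangentAction_mem_levelSet (hg : InvariantMetric G g)
    {μ : Module.Dual ℝ (GroupLieAlgebra 𝓘(ℝ, EG) G)} {h : G} (hh : h ∈ isotropyGroup μ)
    {w : TangentBundle 𝓘(ℝ, E) M} (hw : w ∈ levelSet (simpleLagrangian g V) μ) :
    tangentAction h w ∈ levelSet (simpleLagrangian g V) μ := by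
  intro η
  have h1 := hw (Ad h⁻¹ η)
  rw [momentum, fibreDeriv_simpleLagrangian] at h1 ⊢
  rw [inv_mem_isotropyGroup hh] at h1
  exact (inner_smul_fund hg h w.proj w.snd η).trans h1

end Invariance

/-! ### Unique choice -/

section UniqueChoice

variable {𝔤 : Type*} [Zero 𝔤] {P : 𝔤 → Prop}

theorem theUnique_spec (h : ∃! ξ, P ξ) : P (theUnique P) := by
  rw [theUnique, dif_pos h]
  exact h.choose_spec.1

theorem theUnique_eq (h : ∃! ξ, P ξ) {ξ : 𝔤} (hξ : P ξ) : theUnique P = ξ :=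
  h.unique (theUnique_spec h) hξ

end UniqueChoice

/-! ### Projections of complete lifts to `M` -/

section CompleteLift

variable {E : Type*} [NormedAddCommGroup E] [NormedSpace ℝ E]
  {M : Type*} [TopologicalSpace M] [ChartedSpace E M] [IsManifold 𝓘(ℝ, E) ∞ M]
  {EG : Type*} [NormedAddCommGroup EG] [NormedSpace ℝ EG]
  {G : Type*} [TopologicalSpace G] [ChartedSpace EG G] [Group G] [MulAction G M]

theorem tangentProj_fundC (ξ : GroupLieAlgebra 𝓘(ℝ, EG) G) (w : TangentBundle 𝓘(ℝ, E) M) :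
    tangentProj w (fundC ξ w) = fund w.proj ξ :=
  tangentProj_apply w _

theorem fundC_injective (w : TangentBundle 𝓘(ℝ, E) M)
    (hinj : Function.Injective
      (fund w.proj : GroupLieAlgebra 𝓘(ℝ, EG) G →L[ℝ] TangentSpace 𝓘(ℝ, E) w.proj)) :
    Function.Injective fun ξ : GroupLieAlgebra 𝓘(ℝ, EG) G => fundC ξ w := fun ξ η h =>
  hinj (congrArg Prod.fst (show (fundC ξ w : E × E) = fundC η w from h))

/-- The tangency correction is vertical, so `Tτ` forgets it, whatever `ζ` was chosen. -/
theorem tangentProj_fundBar (L : TangentBundle 𝓘(ℝ, E) M → ℝ)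
    (ξ : GroupLieAlgebra 𝓘(ℝ, EG) G) (w : TangentBundle 𝓘(ℝ, E) M) :
    tangentProj w (fundBar L ξ w) = fund w.proj ξ := by
  rw [fundBar, map_add, tangentProj_fundC, tangentProj_apply]
  exact add_zero _

end CompleteLift

/-! ### Orthogonal projections, Gram matrix and locked inertia tensor -/

section Connections

variable {E : Type*} [NormedAddCommGroup E] [NormedSpace ℝ E]
  {M : Type*} [TopologicalSpace M] [ChartedSpace E M] [IsManifold 𝓘(ℝ, E) ∞ M]
  {EG : Type*} [NormedAddCommGroup EG] [NormedSpace ℝ EG] [FiniteDimensional ℝ EG]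
  {G : Type*} [TopologicalSpace G] [ChartedSpace EG G] [Group G]
  [MulAction G M]
  (g : ContMDiffRiemannianMetric 𝓘(ℝ, E) ∞ E (fun m : M => TangentSpace 𝓘(ℝ, E) m))
  {m : M}

/-- The metric on `𝔨` induced by the fundamental fields at `m`. -/
noncomputable def inducedForm (m : M) (𝔨 : Submodule ℝ (GroupLieAlgebra 𝓘(ℝ, EG) G)) :
    𝔨 →ₗ[ℝ] Module.Dual ℝ 𝔨 :=
  𝔨.subtype.dualMap ∘ₗ lockedInertia EG G g m ∘ₗ 𝔨.subtype

/-- Positive definiteness gives injectivity, and `𝔨` has the dimension of its dual. -/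
theorem inducedForm_bijective
    (hinj : Function.Injective (fund m : GroupLieAlgebra 𝓘(ℝ, EG) G →L[ℝ] TangentSpace 𝓘(ℝ, E) m))
    (𝔨 : Submodule ℝ (GroupLieAlgebra 𝓘(ℝ, EG) G)) :
    Function.Bijective (inducedForm g m 𝔨) := by
  have : FiniteDimensional ℝ (GroupLieAlgebra 𝓘(ℝ, EG) G) :=
    inferInstanceAs (FiniteDimensional ℝ EG)
  have h1 : Function.Injective (inducedForm g m 𝔨) := by
    refine (injective_iff_map_eq_zero _).2 fun ξ hξ => ?_
    have h2 : g.inner m (fund m (ξ : GroupLieAlgebra 𝓘(ℝ, EG) G))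
        (fund m (ξ : GroupLieAlgebra 𝓘(ℝ, EG) G)) = 0 :=
      congrArg (fun l => l ξ) hξ
    have h3 := metric_definite g h2
    exact Subtype.ext (hinj (h3.trans (map_zero _).symm))
  exact ⟨h1, (LinearMap.injective_iff_surjective_of_finrank_eq_finrank
    (Subspace.dual_finrank_eq).symm).1 h1⟩

/-- Orthogonality of `u - ξ̃` to `𝔨` is the linear equation `inducedForm ξ = φ`, with `φ(η) = g(u,
η̃)`. -/
theorem metricConnection_existsUnique
    (hinj : Function.Injective (fund m : GroupLieAlgebra 𝓘(ℝ, EG) G →L[ℝ] TangentSpace 𝓘(ℝ, E) m))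
    (𝔨 : Submodule ℝ (GroupLieAlgebra 𝓘(ℝ, EG) G)) (u : TangentSpace 𝓘(ℝ, E) m) :
    ∃! ξ : GroupLieAlgebra 𝓘(ℝ, EG) G,
      ξ ∈ 𝔨 ∧ ∀ η ∈ 𝔨, g.inner m (u - fund m ξ) (fund m η) = 0 := by
  have hb := inducedForm_bijective g hinj 𝔨
  let φ : Module.Dual ℝ 𝔨 :=
    (g.inner m u).toLinearMap ∘ₗ (fund m).toLinearMap ∘ₗ 𝔨.subtype
  have key : ∀ ξ : 𝔨, inducedForm g m 𝔨 ξ = φ ↔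
      ∀ η ∈ 𝔨, g.inner m (u - fund m (ξ : GroupLieAlgebra 𝓘(ℝ, EG) G)) (fund m η) = 0 := by
    intro ξ
    rw [LinearMap.ext_iff]
    constructor
    · intro h η hη
      have h2 : g.inner m (fund m (ξ : GroupLieAlgebra 𝓘(ℝ, EG) G)) (fund m η) =
        g.inner m u (fund m η) := h ⟨η, hη⟩
      rw [map_sub, sub_apply, h2, sub_self]
    · intro h η
      have h2 := h η η.2
      rw [map_sub, sub_apply, sub_eq_zero] at h2
      exact h2.symm
  obtain ⟨ξ, hξ⟩ := hb.2 φ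
  refine ⟨ξ, ⟨ξ.2, (key ξ).1 hξ⟩, fun ζ hζ => ?_⟩
  exact congrArg Subtype.val (hb.1 (((key ⟨ζ, hζ.1⟩).2 hζ.2).trans hξ.symm))

theorem metricConnection_eq
    (hinj : Function.Injective (fund m : GroupLieAlgebra 𝓘(ℝ, EG) G →L[ℝ] TangentSpace 𝓘(ℝ, E) m))
    {𝔨 : Submodule ℝ (GroupLieAlgebra 𝓘(ℝ, EG) G)} {u : TangentSpace 𝓘(ℝ, E) m}
    {ξ : GroupLieAlgebra 𝓘(ℝ, EG) G} (hξ : ξ ∈ 𝔨)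
    (h : ∀ η ∈ 𝔨, g.inner m (u - fund m ξ) (fund m η) = 0) :
    metricConnection g 𝔨 m u = ξ :=
  theUnique_eq (metricConnection_existsUnique g hinj 𝔨 u) ⟨hξ, h⟩

theorem metricConnection_spec
    (hinj : Function.Injective (fund m : GroupLieAlgebra 𝓘(ℝ, EG) G →L[ℝ] TangentSpace 𝓘(ℝ, E) m))
    (𝔨 : Submodule ℝ (GroupLieAlgebra 𝓘(ℝ, EG) G)) (u : TangentSpace 𝓘(ℝ, E) m) :
    metricConnection g 𝔨 m u ∈ 𝔨 ∧
      ∀ η ∈ 𝔨, g.inner m (u - fund m (metricConnection g 𝔨 m u)) (fund m η) = 0 :=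
  theUnique_spec (metricConnection_existsUnique g hinj 𝔨 u)

/-- Orthogonal projections onto nested spaces compose. -/
theorem metricConnection_comp
    (hinj : Function.Injective (fund m : GroupLieAlgebra 𝓘(ℝ, EG) G →L[ℝ] TangentSpace 𝓘(ℝ, E) m))
    {𝔨 𝔩 : Submodule ℝ (GroupLieAlgebra 𝓘(ℝ, EG) G)} (hle : 𝔨 ≤ 𝔩) (u : TangentSpace 𝓘(ℝ, E) m) :
    metricConnection g 𝔨 m (fund m (metricConnection g 𝔩 m u)) = metricConnection g 𝔨 m u := by
  have h1 := metricConnection_spec g hinj 𝔨 u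
  have h2 := metricConnection_spec g hinj 𝔩 u
  refine metricConnection_eq g hinj h1.1 fun η hη => ?_
  have h3 := h1.2 η hη
  have h4 := h2.2 η (hle hη)
  simp only [map_sub, sub_apply, sub_eq_zero] at h3 h4 ⊢
  rw [← h4, h3]

variable [LieGroup 𝓘(ℝ, EG) ∞ G] {V : M → ℝ} {μ : Module.Dual ℝ (GroupLieAlgebra 𝓘(ℝ, EG) G)}

/-- The Hessian is `g` and `Tτ ξ̃^C = ξ̃`, so the same predicate is handed to `theUnique` on both
sides; no existence is needed. -/
theorem mechConnection_eq (w : TangentBundle 𝓘(ℝ, E) M) (Z : TangentSpace 𝓘(ℝ, E).tangent w) :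
    mechConnection (simpleLagrangian g V) μ w Z =
      fundC (metricConnection g (isotropyAlgebra μ) w.proj (tangentProj w Z)) w := by
  rw [mechConnection, metricConnection]
  congr 2
  funext ξ
  refine propext (and_congr_right fun _ => forall₂_congr fun η _ => ?_)
  rw [hessian_simpleLagrangian, map_sub, tangentProj_fundC, g.symm]

/-- Projecting first to the `𝔤`-directions and then to those of `𝔤_μ` is projecting to the latter at
once. -/
theorem mechConnection_eq_levelConnection (w : TangentBundle 𝓘(ℝ, E) M)
    (hinj : Function.Injective
      (fund w.proj : GroupLieAlgebra 𝓘(ℝ, EG) G →L[ℝ] TangentSpace 𝓘(ℝ, E) w.proj))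
    (Z : TangentSpace 𝓘(ℝ, E).tangent w) :
    mechConnection (simpleLagrangian g V) μ w Z =
      levelConnection (simpleLagrangian g V) μ (mechForm EG G g) w Z := by
  rw [levelConnection, vliftConnection, mechConnection_eq, mechConnection_eq, tangentProj_fundBar,
    mechForm, metricConnection_comp g hinj le_top]

section Gram

variable {ι : Type*} [Fintype ι] [DecidableEq ι] (b : Module.Basis ι ℝ (isotropyAlgebra μ))
  {gram : Matrix ι ι ℝ}
  (hgram : ∀ A B, gram A B = g.inner m (fund m (b A : GroupLieAlgebra 𝓘(ℝ, EG) G))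
      (fund m (b B : GroupLieAlgebra 𝓘(ℝ, EG) G)))

include hgram

/-- A kernel vector `x` of the matrix would put `∑ x_B E_B` in the kernel of the induced form. -/
theorem isUnit_det_gram
    (hinj : Function.Injective (fund m : GroupLieAlgebra 𝓘(ℝ, EG) G →L[ℝ] TangentSpace 𝓘(ℝ, E) m)) :
    IsUnit gram.det := by
  rw [isUnit_iff_ne_zero, Ne, ← Matrix.exists_mulVec_eq_zero_iff]
  rintro ⟨x, hx, h⟩
  apply hx
  have h1 : ∀ A, ∑ B, gram A B * x B = 0 := fun A => congrFun h A
  have h2 : inducedForm g m (isotropyAlgebra μ) (∑ B, x B • b B) = 0 := by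
    refine b.ext fun A => ?_
    have : inducedForm g m (isotropyAlgebra μ) (∑ B, x B • b B) (b A) = ∑ B, x B * gram B A := by
      simp only [map_sum, map_smul, LinearMap.sum_apply, LinearMap.smul_apply, smul_eq_mul, hgram]
      rfl
    rw [this, LinearMap.zero_apply, ← h1 A]
    refine Finset.sum_congr rfl fun B _ => ?_
    rw [hgram, hgram, g.symm, mul_comm]
  have h3 := (inducedForm_bijective g hinj _).1 (h2.trans (map_zero _).symm)
  funext A
  have := congrArg (fun v => b.repr v A) h3
  simpa [Finsupp.single_apply] using this

/-- By symmetry of the Gram matrix, evaluation on `E_C` gives the `C` component of `gram * gram⁻¹`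
applied to `(μ_B)`. -/
theorem inducedForm_gram_inv (hdet : IsUnit gram.det) :
    inducedForm g m (isotropyAlgebra μ) (∑ A, (∑ B, gram⁻¹ A B * μ (b B)) • b A)
      = restrictedMomentum μ := by
  refine b.ext fun C => ?_
  have h1 : inducedForm g m (isotropyAlgebra μ) (∑ A, (∑ B, gram⁻¹ A B * μ (b B)) • b A) (b C) =
      ∑ A, (∑ B, gram⁻¹ A B * μ (b B)) * gram A C := by
    simp only [map_sum, map_smul, LinearMap.sum_apply, LinearMap.smul_apply, smul_eq_mul, hgram]
    rfl
  have h2 : ∀ A, gram A C = gram C A := fun A => by rw [hgram, hgram, g.symm]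
  have h3 : (gram * gram⁻¹).mulVec (fun B => μ (b B)) C = μ (b C) := by
    rw [Matrix.mul_nonsing_inv _ hdet, Matrix.one_mulVec]
  rw [h1]
  refine Eq.trans ?_ h3
  rw [← Matrix.mulVec_mulVec]
  simp only [Matrix.mulVec, dotProduct, h2, mul_comm]

end Gram

theorem inertiaInv_eq {hI : ∀ m : M, Function.Bijective (lockedInertiaSub g μ m)}
    {η : isotropyAlgebra μ} (h : inducedForm g m (isotropyAlgebra μ) η = restrictedMomentum μ) :
    inertiaInv g μ hI m = η := by
  rw [inertiaInv, ← h]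
  exact congrArg Subtype.val
    (LinearEquiv.ofBijective_symm_apply_apply (lockedInertiaSub g μ m) (h := hI m) η)

/-- On `N_μ` one has `g(w, ζ̃) = μ(ζ)`, so the equation that determines the projection of `w`
becomes `I_μ η = j*μ`. -/
theorem metricConnection_levelSet {w : TangentBundle 𝓘(ℝ, E) M}
    (hinj : Function.Injective
      (fund w.proj : GroupLieAlgebra 𝓘(ℝ, EG) G →L[ℝ] TangentSpace 𝓘(ℝ, E) w.proj))
    (hw : w ∈ levelSet (simpleLagrangian g V) μ)
    {η : isotropyAlgebra μ}
    (h : inducedForm g w.proj (isotropyAlgebra μ) η = restrictedMomentum μ) :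
    metricConnection g (isotropyAlgebra μ) w.proj w.snd = η := by
  refine metricConnection_eq g hinj η.2 fun ζ hζ => ?_
  have h1 : g.inner w.proj (fund w.proj (η : GroupLieAlgebra 𝓘(ℝ, EG) G)) (fund w.proj ζ) = μ ζ :=
    congrArg (fun l => l ⟨ζ, hζ⟩) h
  have h2 := hw ζ
  rw [momentum, fibreDeriv_simpleLagrangian] at h2
  rw [map_sub, sub_apply, h1, h2, sub_self]

end Connections

/-! ### Linearity of the complete lift in the Lie algebra element -/

section FundLinear

variable {E : Type*} [NormedAddCommGroup E] [NormedSpace ℝ E]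
  {M : Type*} [TopologicalSpace M] [ChartedSpace E M] [IsManifold 𝓘(ℝ, E) ∞ M]
  {EG : Type*} [NormedAddCommGroup EG] [NormedSpace ℝ EG]
  {G : Type*} [TopologicalSpace G] [ChartedSpace EG G] [Group G] [LieGroup 𝓘(ℝ, EG) ∞ G]
  [MulAction G M] [ContMDiffSMul 𝓘(ℝ, EG) 𝓘(ℝ, E) ∞ G M]

/-- The complete lift `ξ ↦ ξ̃^C(w)` as a linear map. -/
noncomputable def fundCLinear (w : TangentBundle 𝓘(ℝ, E) M) :
    GroupLieAlgebra 𝓘(ℝ, EG) G →ₗ[ℝ] TangentSpace 𝓘(ℝ, E).tangent w where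
  toFun ξ := fundC ξ w
  map_add' ξ η := by
    have e := map_add (mfderiv 𝓘(ℝ, EG) 𝓘(ℝ, E).tangent (fun h : G => tangentAction h w) 1) ξ η
    refine (fundC_eq_mfderiv (ξ + η) w).trans (Eq.trans e ?_)
    exact congrArg₂ (fun a b : E × E => a + b) (fundC_eq_mfderiv ξ w).symm
      (fundC_eq_mfderiv η w).symm
  map_smul' r ξ := by
    have e := map_smul (mfderiv 𝓘(ℝ, EG) 𝓘(ℝ, E).tangent (fun h : G => tangentAction h w) 1) r ξ
    refine (fundC_eq_mfderiv (r • ξ) w).trans (Eq.trans e ?_)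
    exact congrArg (fun a : E × E => r • a) (fundC_eq_mfderiv ξ w).symm

theorem fundC_zero (w : TangentBundle 𝓘(ℝ, E) M) :
    fundC (0 : GroupLieAlgebra 𝓘(ℝ, EG) G) w = 0 :=
  map_zero (fundCLinear w)

theorem fundC_add (ξ η : GroupLieAlgebra 𝓘(ℝ, EG) G) (w : TangentBundle 𝓘(ℝ, E) M) :
    fundC (ξ + η) w = fundC ξ w + fundC η w :=
  map_add (fundCLinear w) ξ η

theorem fundC_sum_smul {ι : Type*} [Fintype ι] (r : ι → ℝ) (ξ : ι → GroupLieAlgebra 𝓘(ℝ, EG) G)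
    (w : TangentBundle 𝓘(ℝ, E) M) :
    fundC (∑ A, r A • ξ A) w = ∑ A, r A • fundC (ξ A) w := by
  refine (map_sum (fundCLinear w) _ _).trans (Finset.sum_congr rfl fun A _ => ?_)
  exact map_smul (fundCLinear w) (r A) (ξ A)

end FundLinear

/-! ### Tangent vectors to the reduced space -/

section ReducedTangent

variable {E : Type*} [NormedAddCommGroup E] [NormedSpace ℝ E]
  {M : Type*} [TopologicalSpace M] [ChartedSpace E M] [IsManifold 𝓘(ℝ, E) ∞ M]
  {EG : Type*} [NormedAddCommGroup EG] [NormedSpace ℝ EG]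
  {G : Type*} [TopologicalSpace G] [ChartedSpace EG G] [Group G]
  [MulAction G M] [ContMDiffSMul 𝓘(ℝ, EG) 𝓘(ℝ, E) ∞ G M]

/-- The action of `TG ≃ G × 𝔤` on `T(TM)`. -/
noncomputable def shiftedTangentAction (h : G) (ξ : GroupLieAlgebra 𝓘(ℝ, EG) G)
    (p : TangentBundle 𝓘(ℝ, E).tangent (TangentBundle 𝓘(ℝ, E) M)) :
    TangentBundle 𝓘(ℝ, E).tangent (TangentBundle 𝓘(ℝ, E) M) :=
  tangentMap 𝓘(ℝ, E).tangent 𝓘(ℝ, E).tangent (tangentAction h)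
    ⟨p.proj, p.snd + fundC ξ p.proj⟩

variable [LieGroup 𝓘(ℝ, EG) ∞ G]

theorem shiftedTangentAction_one_zero
    (p : TangentBundle 𝓘(ℝ, E).tangent (TangentBundle 𝓘(ℝ, E) M)) :
    shiftedTangentAction (1 : G) (0 : GroupLieAlgebra 𝓘(ℝ, EG) G) p = p := by
  have : (tangentAction (1 : G) : TangentBundle 𝓘(ℝ, E) M → _) = id := funext tangentAction_one
  rw [shiftedTangentAction, fundC_zero, add_zero, this, tangentMap_id]
  rfl

/-- The semidirect product law of `TG`: the map induced by `h` carries `(Ad h⁻¹ η)^C` to `η^C`, so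
both shifts can be made before the action. -/
theorem shiftedTangentAction_shiftedTangentAction (h k : G) (ξ η : GroupLieAlgebra 𝓘(ℝ, EG) G)
    (p : TangentBundle 𝓘(ℝ, E).tangent (TangentBundle 𝓘(ℝ, E) M)) :
    shiftedTangentAction k η (shiftedTangentAction h ξ p) =
      shiftedTangentAction (k * h) (ξ + Ad h⁻¹ η) p := by
  obtain ⟨w, X⟩ := p
  have d : ∀ h : G, MDifferentiable 𝓘(ℝ, E).tangent 𝓘(ℝ, E).tangent
      (tangentAction h : TangentBundle 𝓘(ℝ, E) M → _) := fun h =>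
    (contMDiff_tangentAction (EG := EG) h).mdifferentiable (by simp)
  have e : (tangentAction (k * h) : TangentBundle 𝓘(ℝ, E) M → _) =
      tangentAction k ∘ tangentAction h := funext (tangentAction_mul (EG := EG) k h)
  rw [shiftedTangentAction, shiftedTangentAction, shiftedTangentAction, e,
    tangentMap_comp (d k) (d h)]
  refine congrArg (fun v : E × E => tangentMap 𝓘(ℝ, E).tangent 𝓘(ℝ, E).tangent (tangentAction k)
    (⟨tangentAction h w, v⟩ : TangentBundle 𝓘(ℝ, E).tangent (TangentBundle 𝓘(ℝ, E) M))) ?_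
  have e2 := mfderiv_tangentAction_fundC h (Ad h⁻¹ η) w
  rw [Ad_Ad_inv] at e2
  have e3 : X + fundC (ξ + Ad h⁻¹ η) w = (X + fundC ξ w) + fundC (Ad h⁻¹ η) w := by
    rw [fundC_add, add_assoc]
  refine Eq.trans ?_ ((congrArg (fun v : E × E => (mfderiv 𝓘(ℝ, E).tangent 𝓘(ℝ, E).tangent
    (tangentAction h) w v : E × E)) e3).trans (map_add _ _ _)).symm
  exact congrArg (fun v : E × E => _ + v) e2.symm

variable [FiniteDimensional ℝ EG] {L : TangentBundle 𝓘(ℝ, E) M → ℝ}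
  {μ : Module.Dual ℝ (GroupLieAlgebra 𝓘(ℝ, EG) G)}

/-- The relation is already an equivalence, since `G_μ` is closed under products and inverses and
`Ad` of it preserves `𝔤_μ`. So equality in the quotient yields actual `h` and `ξ`. -/
theorem reducedTangent_eq_iff {p q : LevelTangentBundle L μ} :
    (Quot.mk _ p : ReducedTangent L μ) = Quot.mk _ q ↔
      ∃ h ∈ isotropyGroup μ, ∃ ξ ∈ isotropyAlgebra μ, q.1 = shiftedTangentAction h ξ p.1 := by
  refine ⟨fun hpq => ?_, fun h => Quot.sound h⟩
  have hequiv : Equivalence fun p q : LevelTangentBundle L μ =>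
      ∃ h ∈ isotropyGroup μ, ∃ ξ ∈ isotropyAlgebra μ, q.1 = shiftedTangentAction h ξ p.1 := by
    refine ⟨fun p => ⟨1, one_mem_isotropyGroup, 0, zero_mem _,
      (shiftedTangentAction_one_zero p.1).symm⟩, ?_, ?_⟩
    · rintro p q ⟨h, hh, ξ, hξ, e⟩
      refine ⟨h⁻¹, inv_mem_isotropyGroup hh, -Ad h ξ,
        neg_mem (Ad_mem_isotropyAlgebra hh hξ), ?_⟩
      rw [e, shiftedTangentAction_shiftedTangentAction, Ad_neg, Ad_inv_Ad, add_neg_cancel,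
        inv_mul_cancel, shiftedTangentAction_one_zero]
    · rintro p q r ⟨h, hh, ξ, hξ, e⟩ ⟨k, hk, η, hη, e'⟩
      refine ⟨k * h, mul_mem_isotropyGroup hk hh, ξ + Ad h⁻¹ η,
        add_mem hξ (Ad_mem_isotropyAlgebra (inv_mem_isotropyGroup hh) hη), ?_⟩
      rw [e', e, shiftedTangentAction_shiftedTangentAction]
  exact hequiv.eqvGen_iff.1 (Quot.eqvGen_exact hpq)

/-- Vectors tangent to `N_μ` at the same point with equal projections to `N_μ/G_μ` differ by a
vertical vector. -/
theorem ProjectsTo.exists_eq_add_fundC (hfree : ∀ (h : G) (m : M), h • m = m → h = 1)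
    {w : levelSet L μ} {X Y : TangentSpace 𝓘(ℝ, E).tangent (w : TangentBundle 𝓘(ℝ, E) M)}
    {ζ : ReducedTangent L μ} (hX : ProjectsTo w X ζ) (hY : ProjectsTo w Y ζ) :
    ∃ ξ ∈ isotropyAlgebra μ, Y = X + fundC ξ (w : TangentBundle 𝓘(ℝ, E) M) := by
  obtain ⟨hX, rfl⟩ := hX
  obtain ⟨hY, e⟩ := hY
  obtain ⟨h, -, ξ, hξ, e⟩ := reducedTangent_eq_iff.1 e.symm
  have hw : (w : TangentBundle 𝓘(ℝ, E) M) = tangentAction h (w : TangentBundle 𝓘(ℝ, E) M) :=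
    congrArg TotalSpace.proj e
  -- Both vectors sit over the same `w`, so `h` fixes `τ(w)`; freeness leaves only the vertical
  -- shift.
  obtain rfl : h = 1 := hfree h _ (congrArg TotalSpace.proj hw).symm
  have h1 : (tangentAction (1 : G) : TangentBundle 𝓘(ℝ, E) M → _) = id := funext tangentAction_one
  rw [shiftedTangentAction, h1, tangentMap_id] at e
  refine ⟨ξ, hξ, ?_⟩
  injection e with _ e

variable {g : ContMDiffRiemannianMetric 𝓘(ℝ, E) ∞ E (fun m : M => TangentSpace 𝓘(ℝ, E) m)}
  {V : M → ℝ}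

/-- The projection to `N_μ/G_μ` of an invariant Euler-Lagrange field. -/
theorem exists_isReducedField (μ : Module.Dual ℝ (GroupLieAlgebra 𝓘(ℝ, EG) G))
    (hg : InvariantMetric G g)
    (hV : ContMDiff 𝓘(ℝ, E) 𝓘(ℝ, ℝ) ∞ V) (hVinv : ∀ (h : G) (m : M), V (h • m) = V m)
    {Γ : ∀ w : TangentBundle 𝓘(ℝ, E) M, TangentSpace 𝓘(ℝ, E).tangent w}
    (hΓ : IsEulerLagrangeField (simpleLagrangian g V) Γ) :
    ∃ Γr : ReducedSpace (simpleLagrangian g V) μ → ReducedTangent (simpleLagrangian g V) μ,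
      IsReducedField Γ Γr := by
  have hmem := eulerLagrangeField_mem_levelTangent (EG := EG) (G := G) hg hV hVinv hΓ
  refine ⟨Quot.lift (fun w => Quot.mk _ ⟨⟨w, Γ w⟩, w.2, hmem w⟩) ?_, fun w => ⟨hmem w, rfl⟩⟩
  rintro w ⟨w', hw'⟩ ⟨h, hh, e⟩
  refine Quot.sound ⟨h, hh, 0, zero_mem _, ?_⟩
  obtain rfl : _ = w' := e
  rw [fundC_zero, add_zero]
  exact congrArg (fun v : E × E => (⟨tangentAction h (w : TangentBundle 𝓘(ℝ, E) M), v⟩ :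
    TangentBundle 𝓘(ℝ, E).tangent (TangentBundle 𝓘(ℝ, E) M)))
    (eulerLagrangeField_tangentAction (EG := EG) hg hV hVinv hΓ h w)

end ReducedTangent

end Routh

/-! ### Connections on the level set and reconstruction -/

theorem mainTheorem8
    {E : Type*} [NormedAddCommGroup E] [NormedSpace ℝ E] [FiniteDimensional ℝ E]
    {M : Type*} [TopologicalSpace M] [T2Space M] [SecondCountableTopology M]
    [ChartedSpace E M] [IsManifold 𝓘(ℝ, E) ∞ M]
    {EG : Type*} [NormedAddCommGroup EG] [NormedSpace ℝ EG] [FiniteDimensional ℝ EG]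
    {G : Type*} [TopologicalSpace G] [T2Space G] [ConnectedSpace G]
    [ChartedSpace EG G] [Group G] [LieGroup 𝓘(ℝ, EG) ∞ G]
    [MulAction G M] [ContMDiffSMul 𝓘(ℝ, EG) 𝓘(ℝ, E) ∞ G M] [ProperSMul G M]
    (hfree : ∀ (h : G) (m : M), h • m = m → h = 1)
    (g : Bundle.ContMDiffRiemannianMetric 𝓘(ℝ, E) ∞ E (fun m : M => TangentSpace 𝓘(ℝ, E) m))
    (V : M → ℝ) (hV : ContMDiff 𝓘(ℝ, E) 𝓘(ℝ, ℝ) ∞ V)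
    (hginv : ∀ (h : G) (m : M) (u v : TangentSpace 𝓘(ℝ, E) m),
      g.inner (h • m) (mfderiv 𝓘(ℝ, E) 𝓘(ℝ, E) (fun x : M => h • x) m u)
        (mfderiv 𝓘(ℝ, E) 𝓘(ℝ, E) (fun x : M => h • x) m v) = g.inner m u v)
    (hVinv : ∀ (h : G) (m : M), V (h • m) = V m)
    (L : TangentBundle 𝓘(ℝ, E) M → ℝ) (hL : L = Routh.simpleLagrangian g V)
    (Γ : ∀ w : TangentBundle 𝓘(ℝ, E) M, TangentSpace 𝓘(ℝ, E).tangent w)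
    (hΓ : Routh.IsEulerLagrangeField L Γ)
    (μ : Module.Dual ℝ (GroupLieAlgebra 𝓘(ℝ, EG) G))
    {ι : Type*} [Fintype ι] [DecidableEq ι]
    (b : Module.Basis ι ℝ (Routh.isotropyAlgebra μ))
    (gram : M → Matrix ι ι ℝ)
    (hgram : ∀ m A B, gram m A B = g.inner m (Routh.fund m (b A : GroupLieAlgebra 𝓘(ℝ, EG) G))
      (Routh.fund m (b B : GroupLieAlgebra 𝓘(ℝ, EG) G)))
    (Ω : ∀ w : TangentBundle 𝓘(ℝ, E) M,
      TangentSpace 𝓘(ℝ, E).tangent w → TangentSpace 𝓘(ℝ, E).tangent w)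
    (hΩ : Ω = Routh.mechConnection L μ) :
    -- the two connections on the level set coincide
    (∀ w ∈ Routh.levelSet L μ, ∀ Z ∈ Routh.levelTangent EG G L w,
      Routh.mechConnection L μ w Z = Routh.levelConnection L μ (Routh.mechForm EG G g) w Z) ∧
    -- the vertical part of `Γ` is `G^{AB} μ_B Ẽ_A^C`
    (∀ m, IsUnit (gram m).det) ∧
    (∀ w ∈ Routh.levelSet L μ,
      Ω w (Γ w) = ∑ A, (∑ B, (gram w.proj)⁻¹ A B * μ (b B)) •
        Routh.fundC (b A : GroupLieAlgebra 𝓘(ℝ, EG) G) w) ∧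
    -- `I_μ` is invertible, and `G^{AB} μ_B E_A = I_μ⁻¹(j*μ)`
    ∃ hI : ∀ m : M, Function.Bijective (Routh.lockedInertiaSub g μ m),
      (∀ m, ∑ A, (∑ B, (gram m)⁻¹ A B * μ (b B)) • (b A : GroupLieAlgebra 𝓘(ℝ, EG) G)
        = Routh.inertiaInv g μ hI m) ∧
      -- `Γ` reduces to a vector field on `N_μ/G_μ`; reconstruction of its integral curves
      ∃ Γr : Routh.ReducedSpace L μ → Routh.ReducedTangent L μ, Routh.IsReducedField Γ Γr ∧
        ∀ (J : Set ℝ), IsOpen J → J.OrdConnected →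
        ∀ (v : ℝ → Routh.ReducedSpace L μ) (vH : ℝ → Routh.levelSet L μ) (c : ℝ → M),
          Routh.IsReducedIntegralCurveOn v Γr J →
          Routh.IsHorizontalLiftOn Ω vH v J →
          (∀ t, c t = (vH t : TangentBundle 𝓘(ℝ, E) M).proj) →
          -- `c` is `ω^μ`-horizontal
          (∀ t ∈ J, Routh.mechFormSub g μ (c t) (Routh.velocity 𝓘(ℝ, E) c t) = 0) ∧
          ∀ h : ℝ → G, (∀ t ∈ J, h t ∈ Routh.isotropyGroup μ) →
            (∀ t ∈ J, MDifferentiableAt 𝓘(ℝ, ℝ) 𝓘(ℝ, EG) h t) →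
            -- the reconstruction equation, in its original and in its final form
            (∀ t ∈ J,
              Routh.fundC (Routh.maurerCartan (h t) (Routh.velocity 𝓘(ℝ, EG) h t))
                  (vH t : TangentBundle 𝓘(ℝ, E) M) = Ω (vH t) (Γ (vH t)) ↔
              Routh.maurerCartan (h t) (Routh.velocity 𝓘(ℝ, EG) h t)
                = Routh.inertiaInv g μ hI (c t)) ∧
            -- it is the Marsden-Ratiu-Scheurle equation for the curve `c`
            (∀ t ∈ J,
              Routh.MRSEquation g μ hI c h t ↔
              Routh.maurerCartan (h t) (Routh.velocity 𝓘(ℝ, EG) h t)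
                = Routh.inertiaInv g μ hI (c t)) ∧
            -- its solutions reconstruct integral curves and base integral curves of `Γ`
            ((∀ t ∈ J, Routh.maurerCartan (h t) (Routh.velocity 𝓘(ℝ, EG) h t)
                = Routh.inertiaInv g μ hI (c t)) →
              IsMIntegralCurveOn
                (fun t => Routh.tangentAction (h t) (vH t : TangentBundle 𝓘(ℝ, E) M)) Γ J ∧
              ∀ t ∈ J,
                Routh.tangentAction (h t) (vH t : TangentBundle 𝓘(ℝ, E) M)
                  ∈ Routh.levelSet L μ ∧
                (Routh.tangentAction (h t) (vH t : TangentBundle 𝓘(ℝ, E) M)).proj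
                  = h t • c t) := by
  subst hL hΩ
  have : CompleteSpace EG := FiniteDimensional.complete ℝ EG
  have hinj := Routh.fund_injective (E := E) (EG := EG) hfree
  have hdet : ∀ m, IsUnit (gram m).det := fun m => Routh.isUnit_det_gram g b (hgram m) (hinj m)
  -- `I_μ` is by definition the induced form on `𝔤_μ`.
  have hI : ∀ m : M, Function.Bijective (Routh.lockedInertiaSub g μ m) := fun m =>
    Routh.inducedForm_bijective g (hinj m) (Routh.isotropyAlgebra μ)
  have hgi := fun m => Routh.inducedForm_gram_inv g b (hgram m) (hdet m)
  have hcoe : ∀ m, ((∑ A, (∑ B, (gram m)⁻¹ A B * μ (b B)) • b A : Routh.isotropyAlgebra μ) :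
      GroupLieAlgebra 𝓘(ℝ, EG) G) =
      ∑ A, (∑ B, (gram m)⁻¹ A B * μ (b B)) • (b A : GroupLieAlgebra 𝓘(ℝ, EG) G) := fun m => by
    rw [Submodule.coe_sum]; rfl
  have hinv : ∀ m, Routh.inertiaInv g μ hI m =
      ∑ A, (∑ B, (gram m)⁻¹ A B * μ (b B)) • (b A : GroupLieAlgebra 𝓘(ℝ, EG) G) := fun m =>
    (Routh.inertiaInv_eq g (hgi m)).trans (hcoe m)
  have hmc : ∀ w ∈ Routh.levelSet (Routh.simpleLagrangian g V) μ,
      Routh.metricConnection g (Routh.isotropyAlgebra μ) w.proj w.snd =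
        Routh.inertiaInv g μ hI w.proj := fun w hw =>
    (Routh.metricConnection_levelSet g (hinj w.proj) hw (hgi w.proj)).trans
      (Routh.inertiaInv_eq g (hgi w.proj)).symm
  have hΩΓ : ∀ w ∈ Routh.levelSet (Routh.simpleLagrangian g V) μ,
      Routh.mechConnection (Routh.simpleLagrangian g V) μ w (Γ w) =
        Routh.fundC (Routh.inertiaInv g μ hI w.proj) w := fun w hw => by
    rw [Routh.mechConnection_eq, hΓ.secondOrder, hmc w hw]
  refine ⟨fun w _ Z _ => Routh.mechConnection_eq_levelConnection g w (hinj _) Z, hdet,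
    fun w hw => ?_, hI, fun m => (hinv m).symm, ?_⟩
  · rw [hΩΓ w hw, hinv, Routh.fundC_sum_smul]
  obtain ⟨Γr, hΓr⟩ := Routh.exists_isReducedField μ hginv hV hVinv hΓ
  refine ⟨Γr, hΓr, fun J hJ _ v vH c hv hH hc => ?_⟩
  obtain rfl : c = fun t => (vH t : TangentBundle 𝓘(ℝ, E) M).proj := funext hc
  have hproj : ∀ t ∈ J, Routh.tangentProj (vH t : TangentBundle 𝓘(ℝ, E) M)
      (Routh.velocity 𝓘(ℝ, E).tangent (fun s => (vH s : TangentBundle 𝓘(ℝ, E) M)) t) =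
      Routh.velocity 𝓘(ℝ, E) (fun s => (vH s : TangentBundle 𝓘(ℝ, E) M).proj) t := fun t ht =>
    (Routh.tangentProj_apply _ _).trans
      (Routh.mfderiv_tangentBundle_fst (hH.differentiable t ht) (1 : ℝ))
  have hhor : ∀ t ∈ J, Routh.metricConnection g (Routh.isotropyAlgebra μ)
      (vH t : TangentBundle 𝓘(ℝ, E) M).proj
      (Routh.tangentProj (vH t : TangentBundle 𝓘(ℝ, E) M) (Routh.velocity 𝓘(ℝ, E).tangent
        (fun s => (vH s : TangentBundle 𝓘(ℝ, E) M)) t)) = 0 := fun t ht => by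
    have h1 := hH.horizontal t ht
    rw [Routh.mechConnection_eq] at h1
    exact Routh.fundC_injective _ (hinj _) (h1.trans (Routh.fundC_zero _).symm)
  have hc0 : ∀ t ∈ J, Routh.mechFormSub g μ (vH t : TangentBundle 𝓘(ℝ, E) M).proj
      (Routh.velocity 𝓘(ℝ, E) (fun s => (vH s : TangentBundle 𝓘(ℝ, E) M).proj) t) = 0 :=
    fun t ht => by
      have h1 := hhor t ht
      rw [hproj t ht] at h1
      exact h1
  refine ⟨hc0, fun h hh hdiff => ⟨fun t ht => ?_, fun t ht => ?_, fun hrec => ⟨fun t ht => ?_,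
    fun t ht => ⟨Routh.tangentAction_mem_levelSet hginv (hh t ht) (vH t).2, rfl⟩⟩⟩⟩
  · rw [hΩΓ _ (vH t).2]
    exact (Routh.fundC_injective _ (hinj _)).eq_iff
  · rw [Routh.MRSEquation, hc0 t ht, sub_zero]
  -- `vH` is itself a differentiable local lift of `v`, openness of `J` giving a neighbourhood; so
  -- its velocity and `Γ(vH)` have the same projection.
  · have hp := (hv t ht).2 vH (Filter.eventually_of_mem (hJ.mem_nhds ht) hH.lift)
      (hH.differentiable t ht)
    rw [← hH.lift t ht] at hp
    obtain ⟨ξ, hξ, e⟩ := hp.exists_eq_add_fundC hfree (hΓr (vH t))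
    -- Applying `Tτ` to `e` splits the vector `vH t` into the velocity of `c`, orthogonal to the
    -- `𝔤_μ`-directions, and `ξ̃`; hence `ξ` is the projection of `vH t`, already computed in `hmc`.
    have hξ' : ξ = Routh.inertiaInv g μ hI (vH t : TangentBundle 𝓘(ℝ, E) M).proj := by
      rw [← hmc _ (vH t).2]
      refine (Routh.metricConnection_eq g (hinj _) hξ fun η hη => ?_).symm
      have h1 := (Routh.metricConnection_spec g (hinj (vH t : TangentBundle 𝓘(ℝ, E) M).proj)
        (Routh.isotropyAlgebra μ) (Routh.tangentProj (vH t : TangentBundle 𝓘(ℝ, E) M)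
          (Routh.velocity 𝓘(ℝ, E).tangent
            (fun s => (vH s : TangentBundle 𝓘(ℝ, E) M)) t))).2 η hη
      rw [hhor t ht, map_zero, sub_zero] at h1
      rw [← hΓ.secondOrder, e, map_add, Routh.tangentProj_fundC, add_sub_cancel_right]
      exact h1
    -- With `ϑ(ḣ) = ξ` the bracket in the product rule is `Γ(vH)`, and invariance moves `Γ` to the
    -- translated point.
    obtain ⟨d, hvel⟩ := Routh.velocity_tangentAction (hdiff t ht) (hH.differentiable t ht)
    rw [hrec t ht, ← hξ'] at hvel
    refine (d.hasMFDerivAt.congr_mfderiv ?_).hasMFDerivWithinAt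
    refine ContinuousLinearMap.ext_ring ?_
    refine hvel.trans (Eq.trans ?_ (one_smul ℝ (_ : E × E)).symm)
    refine Eq.trans ?_ (Routh.eulerLagrangeField_tangentAction (EG := EG) hginv hV hVinv hΓ
      (h t) (vH t)).symm
    exact congrArg (fun v : E × E => (mfderiv 𝓘(ℝ, E).tangent 𝓘(ℝ, E).tangent
      (Routh.tangentAction (h t)) (vH t : TangentBundle 𝓘(ℝ, E) M) v : E × E)) e.symm
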